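/- Let $n\ge 3$ and let $e_1,\dots,e_n$ be the standard basis of $\mathbb{R}^n$. Let $D_n$ be the Weyl group of the root system $\{\pm e_a\pm e_b: 1\le a<b\le n\}$, generated by the reflections $s_\alpha$ in the simple roots $\alpha_0=e_1+e_2$ and $\alpha_i=e_{i+1}-e_i$ ($1\le i\le n-1$). Let $\ell(\sigma)$ be the length of $\sigma\in D_n$, that is, the least number of factors in an expression of $\sigma$ as a product of these simple reflections, and let $s_\theta\in D_n$ be the reflection in the highest root $\theta=e_{n-1}+e_n$. The number of affine descents of $\sigma\in D_n$ is $$\widetilde{\mathrm{des}}(\sigma)=\#\{0\le i\le n-1:\ \ell(\sigma s_{\alpha_i})<\ell(\sigma)\}+\begin{cases}1&\text{if }\ell(\sigma s_\theta)>\ell(\sigma),\\0&\text{otherwise.}\end{cases}$$ Then the type $D$ affine Eulerian polynomial $$\widetilde{D}_n(x)=\sum_{\sigma\in D_n}x^{\widetilde{\mathrm{des}}(\sigma)}$$ has only real zeros; that is, every complex zero of $\widetilde{D}_n$ is real. -/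

import Mathlib

open Polynomial

noncomputable section

namespace TypeD

/-- The Euclidean space `ℝⁿ`. -/
abbrev E (n : ℕ) : Type := EuclideanSpace ℝ (Fin n)

/-- The standard basis vector `e_k` of `ℝⁿ`, numbered `k = 1, …, n` (and `0` for other `k`). -/
def e (n k : ℕ) : E n := WithLp.toLp 2 fun j => if (j : ℕ) + 1 = k then 1 else 0

/-- The root system of type `D_n`: the vectors `± e_a ± e_b` with `1 ≤ a < b ≤ n`. -/
def roots (n : ℕ) : Set (E n) :=
  {v | ∃ a b : ℕ, 1 ≤ a ∧ a < b ∧ b ≤ n ∧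
    (v = e n a + e n b ∨ v = e n b - e n a ∨ v = e n a - e n b ∨ v = -(e n a + e n b))}

/-- The simple roots of type `D_n` (for `n ≥ 2`), numbered `0, …, n - 1`:
`α_0 = e_1 + e_2` and `α_i = e_{i+1} - e_i` for `1 ≤ i ≤ n - 1`. -/
def simpleRoot (n : ℕ) (i : Fin n) : E n :=
  if (i : ℕ) = 0 then e n 1 + e n 2 else e n (i + 1) - e n i

/-- `θ` is a highest root: it is a root, and `θ - β` is a sum of simple roots for every
root `β`. -/
def IsHighestRoot (n : ℕ) (θ : E n) : Prop :=
  θ ∈ roots n ∧ ∀ β ∈ roots n, θ - β ∈ AddSubmonoid.closure (Set.range (simpleRoot n))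

/-- The highest root `e_{n-1} + e_n` of type `D_n` (for `n ≥ 3`). -/
def highestRoot (n : ℕ) : E n := e n (n - 1) + e n n

/-- The orthogonal reflection of `ℝⁿ` in the hyperplane orthogonal to `v`. -/
def refl (n : ℕ) (v : E n) : E n ≃ₗᵢ[ℝ] E n := (Submodule.span ℝ {v})ᗮ.reflection

/-- The simple reflections, which are the Coxeter generators of the Weyl group. -/
def simpleReflection (n : ℕ) (i : Fin n) : E n ≃ₗᵢ[ℝ] E n := refl n (simpleRoot n i)

/-- The Weyl group of type `D_n`, generated by the simple reflections. -/
def weylGroup (n : ℕ) : Subgroup (E n ≃ₗᵢ[ℝ] E n) :=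
  Subgroup.closure (Set.range (simpleReflection n))

/-- The length of `w`: the least length of a word in the simple reflections with product `w`. -/
def length (n : ℕ) (w : E n ≃ₗᵢ[ℝ] E n) : ℕ :=
  sInf {k | ∃ l : List (Fin n), l.length = k ∧ (l.map (simpleReflection n)).prod = w}

open Classical in
/-- The number of affine descents of `w`: the number of simple reflections `s_i` with
`ℓ(w s_i) < ℓ(w)`, plus one if `ℓ(w s) > ℓ(w)` for the reflection `s` in the highest root. -/
def affineDes (n : ℕ) (w : E n ≃ₗᵢ[ℝ] E n) : ℕ :=
  (Finset.univ.filter fun i : Fin n => length n (w * simpleReflection n i) < length n w).card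
    + if length n w < length n (w * refl n (highestRoot n)) then 1 else 0

theorem exists_word {n : ℕ} {w : E n ≃ₗᵢ[ℝ] E n} (hw : w ∈ weylGroup n) :
    ∃ l : List (Fin n), (l.map (simpleReflection n)).prod = w := by
  have inv : ∀ i, (simpleReflection n i)⁻¹ = simpleReflection n i := fun i => by
    rw [inv_eq_iff_mul_eq_one]
    exact Submodule.reflection_mul_reflection _
  induction hw using Subgroup.closure_induction with
  | mem x hx => obtain ⟨i, rfl⟩ := hx; exact ⟨[i], by simp⟩
  | one => exact ⟨[], rfl⟩
  | mul x y _ _ hx hy =>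
    obtain ⟨l, rfl⟩ := hx
    obtain ⟨m, rfl⟩ := hy
    exact ⟨l ++ m, by simp⟩
  | inv x _ hx =>
    obtain ⟨l, rfl⟩ := hx
    refine ⟨l.reverse, ?_⟩
    rw [List.prod_inv_reverse, List.map_map, List.map_reverse]
    congr 2

theorem refl_apply (n : ℕ) (v x : E n) :
    refl n v x = x - (2 * inner ℝ v x / ‖v‖ ^ 2) • v := by
  rw [refl, Submodule.reflection_orthogonal_apply, Submodule.reflection_singleton_apply]
  simp only [RCLike.ofReal_real_eq_id, id]
  rw [neg_sub, two_smul, ← add_smul]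
  congr 2
  ring

/-- The integer points of `ℝⁿ`. -/
def IsIntegral {n : ℕ} (v : E n) : Prop := ∀ j, ∃ m : ℤ, v j = m

theorem e_cases (n k : ℕ) :
    e n k = 0 ∨ ∃ j : Fin n, (j : ℕ) + 1 = k ∧ e n k = EuclideanSpace.single j 1 := by
  by_cases h : ∃ j : Fin n, (j : ℕ) + 1 = k
  · obtain ⟨j, rfl⟩ := h
    refine Or.inr ⟨j, rfl, ?_⟩
    ext i
    simp [e, Fin.ext_iff]
  · refine Or.inl ?_
    ext i
    have : ¬ (i : ℕ) + 1 = k := fun hi => h ⟨i, hi⟩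
    simp [e, this]

theorem refl_integral {n p q : ℕ} (hpq : p ≠ q) {α v : E n}
    (hα : α = e n p + e n q ∨ α = e n p - e n q) (hv : IsIntegral v) :
    IsIntegral (refl n α v) := by
  have int_e : ∀ k, IsIntegral (e n k) := fun k j => by
    by_cases h : (j : ℕ) + 1 = k
    · exact ⟨1, by simp [e, h]⟩
    · exact ⟨0, by simp [e, h]⟩
  have inn : ∀ k, ∃ m : ℤ, inner ℝ (e n k) v = m := fun k => by
    rcases e_cases n k with h | ⟨j, _, h⟩
    · exact ⟨0, by simp [h]⟩
    · obtain ⟨m, hm⟩ := hv j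
      exact ⟨m, by simp [h, EuclideanSpace.inner_single_left, hm]⟩
  have nrm : ∀ k, inner ℝ (e n k) (e n k) = (0 : ℝ) ∨ inner ℝ (e n k) (e n k) = (1 : ℝ) := by
    intro k
    rcases e_cases n k with h | ⟨j, _, h⟩
    · exact Or.inl (by simp [h])
    · exact Or.inr (by simp [h])
  have orth : inner ℝ (e n p) (e n q) = (0 : ℝ) := by
    rcases e_cases n p with h | ⟨i, hi, h⟩
    · simp [h]
    rcases e_cases n q with h' | ⟨j, hj, h'⟩
    · simp [h']
    have : i ≠ j := fun hij => hpq (by rw [← hi, ← hj, hij])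
    simp [h, h', EuclideanSpace.inner_single_left, this]
  have orth' : inner ℝ (e n q) (e n p) = (0 : ℝ) := by rw [real_inner_comm, orth]
  have int_α : IsIntegral α := fun j => by
    obtain ⟨x, hx⟩ := int_e p j
    obtain ⟨y, hy⟩ := int_e q j
    rcases hα with rfl | rfl
    · exact ⟨x + y, by simp [hx, hy]⟩
    · exact ⟨x - y, by simp [hx, hy]⟩
  have inn_α : ∃ m : ℤ, inner ℝ α v = m := by
    obtain ⟨x, hx⟩ := inn p
    obtain ⟨y, hy⟩ := inn q
    rcases hα with rfl | rfl
    · exact ⟨x + y, by simp [inner_add_left, hx, hy]⟩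
    · exact ⟨x - y, by simp [inner_sub_left, hx, hy]⟩
  have nrm_α : ‖α‖ ^ 2 = inner ℝ (e n p) (e n p) + inner ℝ (e n q) (e n q) := by
    rw [← real_inner_self_eq_norm_sq]
    rcases hα with rfl | rfl
    · simp only [inner_add_left, inner_add_right, orth, orth']
      ring
    · simp only [inner_sub_left, inner_sub_right, orth, orth']
      ring
  obtain ⟨m, hm⟩ := inn_α
  have coef : ∃ c : ℤ, 2 * inner ℝ α v / ‖α‖ ^ 2 = c := by
    rw [nrm_α, hm]
    rcases nrm p with h | h <;> rcases nrm q with h' | h' <;> rw [h, h']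
    · exact ⟨0, by simp⟩
    · exact ⟨2 * m, by simp⟩
    · exact ⟨2 * m, by simp⟩
    · exact ⟨m, by ring⟩
  obtain ⟨c, hc⟩ := coef
  intro j
  obtain ⟨x, hx⟩ := hv j
  obtain ⟨y, hy⟩ := int_α j
  refine ⟨x - c * y, ?_⟩
  rw [refl_apply, hc]
  simp [hx, hy]

theorem simpleReflection_integral {n : ℕ} (i : Fin n) {v : E n} (hv : IsIntegral v) :
    IsIntegral (simpleReflection n i v) := by
  by_cases h : (i : ℕ) = 0
  · exact refl_integral (p := 1) (q := 2) (by omega) (Or.inl (by simp [simpleRoot, h])) hv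
  · exact refl_integral (p := i + 1) (q := i) (by omega) (Or.inr (by simp [simpleRoot, h])) hv

theorem weylGroup_integral {n : ℕ} {w : E n ≃ₗᵢ[ℝ] E n} (hw : w ∈ weylGroup n) {v : E n}
    (hv : IsIntegral v) : IsIntegral (w v) := by
  obtain ⟨l, rfl⟩ := exists_word hw
  clear hw
  induction l with
  | nil => exact hv
  | cons i l ih => exact simpleReflection_integral i ih

instance weylGroup_finite (n : ℕ) : Finite (weylGroup n) := by
  have fin : {v : E n | IsIntegral v ∧ ‖v‖ ≤ 1}.Finite := by
    have : ((fun f : Fin n → ℤ => (WithLp.toLp 2 fun j => (f j : ℝ) : E n)) ''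
        (Set.pi Set.univ fun _ => Set.Icc (-1 : ℤ) 1)).Finite :=
      (Set.Finite.pi fun _ => Set.finite_Icc (-1 : ℤ) 1).image _
    refine this.subset ?_
    rintro v ⟨hv, h1⟩
    choose f hf using hv
    refine ⟨f, fun j _ => ?_, ?_⟩
    · have := (PiLp.norm_apply_le v j).trans h1
      rw [hf, Real.norm_eq_abs, abs_le] at this
      constructor
      · exact_mod_cast this.1
      · exact_mod_cast this.2
    · ext j
      exact (hf j).symm
  have := fin.to_subtype
  let F : weylGroup n → Fin n → {v : E n | IsIntegral v ∧ ‖v‖ ≤ 1} := fun w j =>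
    ⟨w.1 (EuclideanSpace.single j 1), weylGroup_integral w.2 (fun k => by
      by_cases h : k = j
      · exact ⟨1, by simp [h]⟩
      · exact ⟨0, by simp [h]⟩), by simp⟩
  refine Finite.of_injective F fun w w' h => ?_
  apply Subtype.ext
  apply LinearIsometryEquiv.toLinearEquiv_injective
  apply LinearEquiv.toLinearMap_injective
  refine (EuclideanSpace.basisFun (Fin n) ℝ).toBasis.ext fun j => ?_
  have := congrArg Subtype.val (congrFun h j)
  simpa [F] using this

instance (n : ℕ) : Fintype (weylGroup n) := Fintype.ofFinite _

/-- The affine Eulerian polynomial of type `D_n`. -/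
def affineEulerian (n : ℕ) : ℝ[X] := ∑ w : weylGroup n, X ^ affineDes n (w : E n ≃ₗᵢ[ℝ] E n)

theorem isHighestRoot_highestRoot {n : ℕ} (hn : 3 ≤ n) : IsHighestRoot n (highestRoot n) := by
  set C := AddSubmonoid.closure (Set.range (simpleRoot n)) with hC
  have hs : ∀ i, simpleRoot n i ∈ C := fun i => AddSubmonoid.subset_closure ⟨i, rfl⟩
  have sub : ∀ a b, 1 ≤ a → a ≤ b → b ≤ n → e n b - e n a ∈ C := by
    intro a b ha hab
    induction b, hab using Nat.le_induction with
    | base => intro _; simp [C.zero_mem]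
    | succ b hab ih =>
      intro hb
      have h := hs ⟨b, by omega⟩
      rw [simpleRoot, if_neg (by simp; omega)] at h
      have := C.add_mem h (ih (by omega))
      simpa using this
  have add : ∀ a b, 1 ≤ a → a < b → b ≤ n → e n a + e n b ∈ C := by
    intro a b ha hab hb
    have h := hs ⟨0, by omega⟩
    rw [simpleRoot, if_pos rfl] at h
    have := C.add_mem (C.add_mem h (sub 1 a le_rfl ha (by omega))) (sub 2 b (by omega) (by omega) hb)
    convert this using 1
    abel
  have add' : ∀ a b, 1 ≤ a → 2 ≤ b → a ≤ n → b ≤ n → e n a + e n b ∈ C := by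
    intro a b ha hb han hbn
    rcases lt_trichotomy a b with h | h | h
    · exact add a b ha h hbn
    · subst h
      have := C.add_mem (add 1 a le_rfl (by omega) hbn) (sub 1 a le_rfl ha hbn)
      convert this using 1
      abel
    · rw [add_comm]
      exact add b a (by omega) h han
  refine ⟨⟨n - 1, n, by omega, by omega, le_rfl, Or.inl rfl⟩, ?_⟩
  rintro β ⟨a, b, ha, hab, hb, rfl | rfl | rfl | rfl⟩ <;> rw [highestRoot, ← hC]
  · convert C.add_mem (sub a (n - 1) ha (by omega) (by omega)) (sub b n (by omega) hb le_rfl)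
      using 1
    abel
  · convert C.add_mem (add' a (n - 1) ha (by omega) (by omega) (by omega))
      (sub b n (by omega) hb le_rfl) using 1
    abel
  · convert C.add_mem (add' b (n - 1) (by omega) (by omega) (by omega) (by omega))
      (sub a n ha (by omega) le_rfl) using 1
    abel
  · convert C.add_mem (add' a (n - 1) ha (by omega) (by omega) (by omega))
      (add' b n (by omega) (by omega) (by omega) le_rfl) using 1
    abel

end TypeD

end

noncomputable section

namespace TypeD

/-! The count is first moved from the group to words. If `r` is dominant, the right descents of `w`,
and the comparison of `w` with `w` times the reflection in the highest root, are read off the signs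
of scalar products of roots with `w⁻¹ r`. Letting `r` run through the two vectors `(±1, 2, …, n)`
makes `w⁻¹ r` run once through all signed permutations, so that each group element is counted twice
(`two_mul_sum_weylGroup`).

Signed words grow by appending a last letter, and their descent polynomials, sorted by last letter,
evolve under the linear operator `step`. The extra affine condition concerns the last two letters.
It turns the affine count into the total of a half-period translate of one descent sequence minus
`z` times a lift of the preceding one (`sum_affineTransfer`). Translation and lift both commute with
`step`, so their difference again evolves under `step`; divided by `2 * z` it is `affineTransfer`
(`affineTransfer_eq`). Thus the affine Eulerian polynomial at `z` is `2 * z` times the total of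
`affineTransfer` (`aeval_affineEulerian`).

Now let `z` lie in the upper half plane. The operator preserves interlacing (`Interlaced.step`), and
an interlaced sequence with total zero vanishes identically, because no nontrivial splitting of it
into two consecutive blocks can balance. The initial sequence is not interlaced, but the third
iterate is. This is a finite check: positivity of an oriented area of two real polynomials in `z` is
certified by a continued fraction. Since the first entry of each sequence is the total of the
preceding one, a zero total would propagate back to the third iterate, whose entries do not vanish.
The few smaller cases are explicit, and the lower half plane follows by conjugation. -/

/-! ### Oriented areas, the transfer operator and interlacing -/

/-- The oriented area `Im (conj a * b)` spanned by two complex numbers. -/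
def wedge (a b : ℂ) : ℝ := a.re * b.im - a.im * b.re

theorem wedge_self (a : ℂ) : wedge a a = 0 := by
  simp only [wedge]; ring

theorem wedge_sum_left {ι : Type*} (s : Finset ι) (f : ι → ℂ) (b : ℂ) :
    wedge (∑ i ∈ s, f i) b = ∑ i ∈ s, wedge (f i) b := by
  simp only [wedge, Complex.re_sum, Complex.im_sum, Finset.sum_mul, Finset.sum_sub_distrib]

theorem wedge_sum_right {ι : Type*} (s : Finset ι) (f : ι → ℂ) (a : ℂ) :
    wedge a (∑ i ∈ s, f i) = ∑ i ∈ s, wedge a (f i) := by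
  simp only [wedge, Complex.re_sum, Complex.im_sum, Finset.mul_sum, Finset.sum_sub_distrib]

theorem wedge_mul_self (z a : ℂ) : wedge a (z * a) = z.im * Complex.normSq a := by
  simp only [wedge, Complex.mul_re, Complex.mul_im, Complex.normSq_apply]; ring

/-- The threshold that the `p`-th last letter of a signed word of length `n + 1` imposes on the
preceding letter. -/
def thr (n p : ℕ) : ℕ := if p ≤ n then p else p - 1

/-- The sum of the first `m` entries of `h`, with those before position `t` multiplied by `z`. -/
def window (z : ℂ) (m : ℕ) (h : ℕ → ℂ) (t : ℕ) : ℂ :=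
  ∑ q ∈ Finset.range m, (if q < t then z else 1) * h q

/-- The transfer operator that appends a last letter to signed words of length `n`. -/
def step (z : ℂ) (n : ℕ) (h : ℕ → ℂ) (p : ℕ) : ℂ := window z (2 * n) h (thr n p)

/-- The first `m` entries of `h` followed by their multiples by `z` go round the origin in
counterclockwise order. -/
def Interlaced (z : ℂ) (m : ℕ) (h : ℕ → ℂ) : Prop :=
  ∀ i j, i ≤ j → j < m → 0 ≤ wedge (h i) (h j) ∧ 0 ≤ wedge (h j) (z * h i)

theorem window_eq (z : ℂ) {m : ℕ} (h : ℕ → ℂ) {t : ℕ} (ht : t ≤ m) :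
    window z m h t = z * ∑ q ∈ Finset.Ico 0 t, h q + ∑ q ∈ Finset.Ico t m, h q := by
  rw [window, Finset.range_eq_Ico, ← Finset.sum_Ico_consecutive _ (Nat.zero_le t) ht,
    Finset.mul_sum]
  congr 1
  · refine Finset.sum_congr rfl fun q hq => ?_
    rw [if_pos (Finset.mem_Ico.1 hq).2]
  · refine Finset.sum_congr rfl fun q hq => ?_
    rw [if_neg (not_lt.2 (Finset.mem_Ico.1 hq).1), one_mul]

theorem Interlaced.wedge_Ico {z : ℂ} {m : ℕ} {h : ℕ → ℂ} (H : Interlaced z m h) {a b c d : ℕ}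
    (hbc : b ≤ c) (hd : d ≤ m) :
    0 ≤ wedge (∑ q ∈ Finset.Ico a b, h q) (∑ q ∈ Finset.Ico c d, h q) ∧
      0 ≤ wedge (∑ q ∈ Finset.Ico c d, h q) (z * ∑ q ∈ Finset.Ico a b, h q) := by
  simp only [Finset.mul_sum, wedge_sum_left, wedge_sum_right]
  constructor <;> refine Finset.sum_nonneg fun i hi => Finset.sum_nonneg fun j hj => ?_ <;>
    rw [Finset.mem_Ico] at hi hj
  · exact (H _ _ (by omega) (by omega)).1
  · exact (H _ _ (by omega) (by omega)).2

/-- Cut the sequence at `s` and `t` into blocks with sums `A`, `B`, `C`; the two windows are `z A +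
B + C` and `z (A + B) + C`. Both areas expand into nonnegative areas between adjacent blocks and
terms of the form `Im z * |X|²`; the blocks `A` and `C` never need to be compared separately. -/
theorem Interlaced.window {z : ℂ} (hz : 0 < z.im) {m : ℕ} {h : ℕ → ℂ} (H : Interlaced z m h)
    {s t : ℕ} (hst : s ≤ t) (ht : t ≤ m) :
    0 ≤ wedge (window z m h s) (window z m h t) ∧
      0 ≤ wedge (window z m h t) (z * window z m h s) := by
  rw [window_eq z h ht, window_eq z h (hst.trans ht),
    ← Finset.sum_Ico_consecutive _ (Nat.zero_le s) hst, ← Finset.sum_Ico_consecutive _ hst ht]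
  have hAB := H.wedge_Ico (a := 0) (b := s) (c := s) (d := t) le_rfl ht
  have hBC := H.wedge_Ico (a := s) (b := t) (c := t) (d := m) le_rfl le_rfl
  generalize ∑ q ∈ Finset.Ico 0 s, h q = A at *
  generalize ∑ q ∈ Finset.Ico s t, h q = B at *
  generalize ∑ q ∈ Finset.Ico t m, h q = C at *
  have hBB : 0 ≤ wedge B (z * B) := by
    rw [wedge_mul_self]; exact mul_nonneg hz.le (Complex.normSq_nonneg _)
  have hCA : 0 ≤ wedge (C + z * A) (z * (C + z * A)) := by
    rw [wedge_mul_self]; exact mul_nonneg hz.le (Complex.normSq_nonneg _)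
  have hn := Complex.normSq_nonneg z
  constructor
  · have : wedge (z * A + (B + C)) (z * (A + B) + C) = Complex.normSq z * wedge A B
        + wedge B (z * A) + wedge B (z * B) + wedge B C + wedge C (z * B) := by
      simp only [wedge, Complex.mul_re, Complex.mul_im, Complex.add_re, Complex.add_im,
        Complex.normSq_apply]
      ring
    rw [this]
    have := mul_nonneg hn hAB.1
    linarith [hAB.2, hBC.1, hBC.2]
  · have : wedge (z * (A + B) + C) (z * (z * A + (B + C))) =
        wedge (C + z * A) (z * (C + z * A)) + wedge C (z * B)
        + Complex.normSq z * (wedge A B + wedge B C + wedge B (z * A)) := by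
      simp only [wedge, Complex.mul_re, Complex.mul_im, Complex.add_re, Complex.add_im,
        Complex.normSq_apply]
      ring
    rw [this]
    have := mul_nonneg hn (add_nonneg (add_nonneg hAB.1 hBC.1) hAB.2)
    linarith [hBC.2]

theorem thr_mono (n : ℕ) {i j : ℕ} (hij : i ≤ j) : thr n i ≤ thr n j := by
  simp only [thr]; split_ifs <;> omega

theorem thr_le {n p : ℕ} (hp : p < 2 * (n + 1)) : thr n p ≤ 2 * n := by
  simp only [thr]; split_ifs <;> omega

theorem Interlaced.step {z : ℂ} (hz : 0 < z.im) {n : ℕ} {h : ℕ → ℂ}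
    (H : Interlaced z (2 * n) h) : Interlaced z (2 * (n + 1)) (step z n h) :=
  fun _ _ hij hj => H.window hz (thr_mono n hij) (thr_le hj)

/-- If an initial block has sum `B`, the remaining block has sum `-B`, and interlacing gives `0 ≤
wedge (-B) (z * B) = -Im z * |B|²`. So every partial sum vanishes, hence every entry. -/
theorem Interlaced.eq_zero_of_sum_eq_zero {z : ℂ} (hz : 0 < z.im) {m : ℕ} {h : ℕ → ℂ}
    (H : Interlaced z m h) (h0 : ∑ q ∈ Finset.range m, h q = 0) {q : ℕ} (hq : q < m) :
    h q = 0 := by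
  have key : ∀ t ≤ m, ∑ q ∈ Finset.Ico 0 t, h q = 0 := fun t ht => by
    have h1 := (H.wedge_Ico (a := 0) (b := t) (c := t) (d := m) le_rfl le_rfl).2
    rw [Finset.range_eq_Ico, ← Finset.sum_Ico_consecutive _ (Nat.zero_le t) ht] at h0
    generalize ∑ q ∈ Finset.Ico 0 t, h q = B at *
    rw [eq_neg_of_add_eq_zero_right h0] at h1
    have h2 : wedge (-B) (z * B) = -(z.im * Complex.normSq B) := by
      rw [← wedge_mul_self]; simp only [wedge, Complex.neg_re, Complex.neg_im]; ring
    rw [h2] at h1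
    by_contra hB
    have := mul_pos hz (Complex.normSq_pos.2 hB)
    linarith
  have h1 := key (q + 1) hq
  rwa [Finset.sum_Ico_succ_top (Nat.zero_le q), key q hq.le, zero_add] at h1

/-! ### Operations that commute with the transfer operator -/

theorem window_zero (z : ℂ) (m : ℕ) (h : ℕ → ℂ) :
    window z m h 0 = ∑ q ∈ Finset.range m, h q := by
  simp [window]

theorem window_succ (z : ℂ) {m : ℕ} (h : ℕ → ℂ) {t : ℕ} (ht : t < m) :
    window z m h (t + 1) = window z m h t + (z - 1) * h t := by
  rw [window_eq z h ht, window_eq z h ht.le, Finset.sum_Ico_succ_top (Nat.zero_le t),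
    Finset.sum_eq_sum_Ico_succ_bot ht]
  ring

theorem step_zero (z : ℂ) (n : ℕ) (h : ℕ → ℂ) :
    step z n h 0 = ∑ q ∈ Finset.range (2 * n), h q := by
  simp [step, thr, window_zero]

theorem step_succ_left (z : ℂ) {n : ℕ} (h : ℕ → ℂ) {p : ℕ} (hp : p < n) :
    step z n h (p + 1) = step z n h p + (z - 1) * h p := by
  rw [step, step, thr, thr, if_pos (by omega), if_pos (by omega), window_succ z h (by omega)]

theorem step_middle (z : ℂ) (n : ℕ) (h : ℕ → ℂ) : step z n h (n + 1) = step z n h n := by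
  simp [step, thr]

theorem step_succ_right (z : ℂ) {n : ℕ} (h : ℕ → ℂ) {j : ℕ} (hj : j < n) :
    step z n h (n + 1 + (j + 1)) = step z n h (n + 1 + j) + (z - 1) * h (n + j) := by
  rw [step, step, thr, thr, if_neg (by omega), if_neg (by omega),
    show n + 1 + (j + 1) - 1 = n + j + 1 by omega, show n + 1 + j - 1 = n + j by omega,
    window_succ z h (by omega)]

/-- The output of the operator is determined by its first value and its consecutive differences,
with a repeated value in the middle. Commutation relations can therefore be checked on differences,
where they are local. -/
theorem eq_step {z : ℂ} {n : ℕ} {h f : ℕ → ℂ} (h0 : f 0 = step z n h 0)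
    (hl : ∀ p < n, f (p + 1) = f p + (z - 1) * h p) (hm : f (n + 1) = f n)
    (hr : ∀ j < n, f (n + 1 + (j + 1)) = f (n + 1 + j) + (z - 1) * h (n + j))
    {p : ℕ} (hp : p < 2 * (n + 1)) : f p = step z n h p := by
  have left : ∀ p ≤ n, f p = step z n h p := fun p => by
    induction p with
    | zero => exact fun _ => h0
    | succ p ih => exact fun hp => by rw [hl p hp, step_succ_left z h hp, ih (by omega)]
  have right : ∀ j ≤ n, f (n + 1 + j) = step z n h (n + 1 + j) := fun j => by
    induction j with
    | zero => exact fun _ => by rw [add_zero, hm, step_middle, left n le_rfl]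
    | succ j ih => exact fun hj => by rw [hr j hj, step_succ_right z h hj, ih (by omega)]
  rcases le_or_gt p n with h | h
  · exact left p h
  · obtain ⟨j, rfl⟩ := Nat.exists_eq_add_of_le (Nat.succ_le_of_lt h)
    exact right j (by omega)

theorem step_congr {z : ℂ} {n : ℕ} {h h' : ℕ → ℂ} (H : ∀ q < 2 * n, h q = h' q) (p : ℕ) :
    step z n h p = step z n h' p := by
  rw [step, step, window, window]
  exact Finset.sum_congr rfl fun q hq => by rw [H q (Finset.mem_range.1 hq)]

theorem step_sub (z : ℂ) (n : ℕ) (h h' : ℕ → ℂ) (c : ℂ) (p : ℕ) :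
    step z n (fun q => h q - c * h' q) p = step z n h p - c * step z n h' p := by
  simp only [step, window, Finset.mul_sum, ← Finset.sum_sub_distrib]
  exact Finset.sum_congr rfl fun q _ => by ring

theorem step_mul (z : ℂ) (n : ℕ) (h : ℕ → ℂ) (c : ℂ) (p : ℕ) :
    step z n (fun q => c * h q) p = c * step z n h p := by
  simp only [step, window, Finset.mul_sum]
  exact Finset.sum_congr rfl fun q _ => by ring

/-- Translation by half a period of a sequence with `h (p + 2 * n) = z * h p`. -/
def halfTurn (z : ℂ) (n : ℕ) (h : ℕ → ℂ) (p : ℕ) : ℂ :=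
  if p < n then h (p + n) else z * h (p - n)

theorem halfTurn_left (z : ℂ) {n : ℕ} (h : ℕ → ℂ) {p : ℕ} (hp : p < n) :
    halfTurn z n h p = h (n + p) := by
  rw [halfTurn, if_pos hp, add_comm]

theorem halfTurn_right (z : ℂ) (n : ℕ) (h : ℕ → ℂ) (p : ℕ) :
    halfTurn z n h (n + p) = z * h p := by
  rw [halfTurn, if_neg (by omega), Nat.add_sub_cancel_left]

theorem sum_halfTurn (z : ℂ) (n : ℕ) (h : ℕ → ℂ) :
    ∑ p ∈ Finset.range (2 * n), halfTurn z n h p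
      = ∑ p ∈ Finset.range n, (h (n + p) + z * h p) := by
  rw [two_mul, Finset.sum_range_add, Finset.sum_add_distrib]
  congr 1
  · exact Finset.sum_congr rfl fun p hp => halfTurn_left z h (Finset.mem_range.1 hp)
  · exact Finset.sum_congr rfl fun p _ => halfTurn_right z n h p

theorem step_last (z : ℂ) (n : ℕ) (h : ℕ → ℂ) :
    step z n h (n + 1 + n) = z * step z n h 0 := by
  rw [step, thr, if_neg (by omega), window_eq z h (by omega), step_zero, Finset.range_eq_Ico,
    show n + 1 + n - 1 = 2 * n by omega]
  simp

/-- The half turn exchanges the two halves, so the two families of difference equations are swapped.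
The seams are swapped as well: the repeated middle value corresponds to the fact that the last entry
is `z` times the first (`step_last`). -/
theorem halfTurn_step (z : ℂ) (n : ℕ) (h : ℕ → ℂ) {p : ℕ} (hp : p < 2 * (n + 1)) :
    halfTurn z (n + 1) (step z n h) p = step z n (halfTurn z n h) p := by
  refine eq_step ?_ (fun p hp => ?_) ?_ (fun j hj => ?_) hp
  · rw [halfTurn_left z _ (Nat.succ_pos n), step_zero, sum_halfTurn, add_zero, step_middle, step,
      thr, if_pos le_rfl, window_eq z h (by omega), Finset.sum_add_distrib,
      ← Finset.mul_sum, Finset.sum_Ico_eq_sum_range, Finset.sum_Ico_eq_sum_range, add_comm]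
    simp [two_mul]
  · rw [halfTurn_left z _ (by omega), halfTurn_left z _ (by omega), halfTurn_left z _ hp,
      step_succ_right z h hp]
  · rw [show n + 1 = n + 1 + 0 from rfl, halfTurn_right, halfTurn_left z _ (by omega), step_last]
  · rw [halfTurn_right, halfTurn_right, halfTurn_right, step_succ_left z h hj]
    ring

/-- The effect on one half of a sequence of inserting an additional letter of fixed sign. -/
def halfLift (n : ℕ) (h : ℕ → ℂ) (j : ℕ) : ℂ := (n - j) * h j + j * h (j - 1)

/-- The effect of inserting an additional letter of fixed sign into signed words of length `n`,
in any position but the last. -/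
def lift (n : ℕ) (h : ℕ → ℂ) (p : ℕ) : ℂ :=
  if p ≤ n then halfLift n h p else halfLift n (fun j => h (n + j)) (p - (n + 1))

theorem lift_left {n : ℕ} (h : ℕ → ℂ) {p : ℕ} (hp : p ≤ n) : lift n h p = halfLift n h p :=
  if_pos hp

theorem lift_right (n : ℕ) (h : ℕ → ℂ) (j : ℕ) :
    lift n h (n + 1 + j) = halfLift n (fun j => h (n + j)) j := by
  rw [lift, if_neg (by omega), Nat.add_sub_cancel_left]

theorem sum_halfLift (n : ℕ) (h : ℕ → ℂ) :
    ∑ j ∈ Finset.range (n + 1), halfLift n h j = (n + 1) * ∑ j ∈ Finset.range n, h j := by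
  simp only [halfLift]
  rw [Finset.sum_add_distrib, Finset.sum_range_succ, Finset.sum_range_succ' (fun j => (j : ℂ) * _),
    Finset.mul_sum]
  simp only [sub_self, zero_mul, add_zero, Nat.cast_zero, Nat.add_sub_cancel]
  rw [← Finset.sum_add_distrib]
  refine Finset.sum_congr rfl fun j _ => ?_
  push_cast
  ring

theorem sum_lift (n : ℕ) (h : ℕ → ℂ) :
    ∑ p ∈ Finset.range (2 * (n + 1)), lift n h p = (n + 1) * ∑ p ∈ Finset.range (2 * n), h p := by
  rw [two_mul, two_mul, Finset.sum_range_add _ (n + 1) (n + 1), Finset.sum_range_add _ n n, mul_add, ← sum_halfLift,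
    ← sum_halfLift]
  congr 1
  · exact Finset.sum_congr rfl fun p hp => lift_left h (by rw [Finset.mem_range] at hp; omega)
  · exact Finset.sum_congr rfl fun p _ => lift_right n h p

theorem lift_step (z : ℂ) (n : ℕ) (h : ℕ → ℂ) {p : ℕ} (hp : p < 2 * (n + 1 + 1)) :
    lift (n + 1) (step z n h) p = step z (n + 1) (lift n h) p := by
  refine eq_step ?_ (fun p hp => ?_) ?_ (fun j hj => ?_) hp
  · rw [lift_left _ (Nat.zero_le _), step_zero, sum_lift, halfLift, step_zero]
    push_cast
    ring
  · rw [lift_left _ (by omega), lift_left _ (by omega), lift_left _ (by omega)]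
    simp only [halfLift]
    -- The boundary cases are harmless: at the start of a half the truncated index `p - 1` has
    -- coefficient zero, and at its end the coefficient `n - j` removes the entry that would belong
    -- to the other half.
    rcases Nat.eq_zero_or_pos p with rfl | h0
    · rcases Nat.eq_zero_or_pos n with rfl | hn
      · simp
      · rw [step_succ_left z h hn]
        push_cast
        simp
        ring
    · obtain ⟨p, rfl⟩ := Nat.exists_eq_succ_of_ne_zero h0.ne'
      have e1 := step_succ_left z h (show p < n by omega)
      rcases (show p + 1 = n ∨ p + 1 < n by omega) with rfl | h1
      · simp only [Nat.succ_eq_add_one, Nat.add_sub_cancel, e1]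
        push_cast
        ring
      · simp only [Nat.succ_eq_add_one, Nat.add_sub_cancel, step_succ_left z h h1, e1]
        push_cast
        ring
  · rw [show n + 1 + 1 = n + 1 + 1 + 0 from rfl, lift_right, lift_left _ (by omega)]
    simp only [halfLift, step_middle, add_zero, Nat.add_sub_cancel]
    push_cast
    ring
  · rw [lift_right, lift_right, lift_right]
    simp only [halfLift]
    rcases Nat.eq_zero_or_pos j with rfl | h0
    · rcases Nat.eq_zero_or_pos n with rfl | hn
      · simp
      · have e1 := step_succ_right z h hn
        simp only [zero_add] at e1 ⊢
        simp only [e1]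
        push_cast
        simp
        ring
    · obtain ⟨p, rfl⟩ := Nat.exists_eq_succ_of_ne_zero h0.ne'
      have e1 := step_succ_right z h (show p < n by omega)
      rcases (show p + 1 = n ∨ p + 1 < n by omega) with rfl | h1
      · simp only [Nat.succ_eq_add_one, Nat.add_sub_cancel, e1]
        push_cast
        ring
      · have e2 := step_succ_right z h h1
        simp only [Nat.succ_eq_add_one, Nat.add_sub_cancel, e2, e1]
        push_cast
        ring

/-! ### The descent sequence and the affine sequence -/

/-- The generating polynomials, at `z`, of the type `D` descents of signed words of length
`k + 2` with given last letter. -/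
def transfer (z : ℂ) : ℕ → ℕ → ℂ
  | 0, p => 2 * (if p = 0 then 1 else if p = 3 then z ^ 2 else z)
  | k + 1, p => step z (k + 2) (transfer z k) p

/-- A refinement, at `z`, of the type `D` affine Eulerian polynomial of index `k + 3`, up to the
factor `2 * z`. -/
def affineTransfer (z : ℂ) : ℕ → ℕ → ℂ
  | 0, p => if p = 2 ∨ p = 3 then 1 + z ^ 2 else 2 * z
  | k + 1, p => step z (k + 3) (affineTransfer z k) p

/-- Both sides obey the same linear recursion, since half turn and lift commute with `step`. Only
the smallest case has to be computed, and it dictates the initial values of `affineTransfer`. -/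
theorem affineTransfer_eq (z : ℂ) (k : ℕ) : ∀ p < 2 * (k + 3),
    halfTurn z (k + 3) (transfer z (k + 1)) p - z * lift (k + 2) (transfer z k) p
      = 2 * z * affineTransfer z k p := by
  induction k with
  | zero =>
    intro p hp
    interval_cases p <;>
      simp [halfTurn, transfer, step, window, thr, lift, halfLift, affineTransfer,
        Finset.sum_range_succ] <;> ring
  | succ k ih =>
    intro p hp
    have h1 : halfTurn z (k + 1 + 3) (transfer z (k + 1 + 1)) p
        = step z (k + 3) (halfTurn z (k + 3) (transfer z (k + 1))) p :=
      halfTurn_step z (k + 3) (transfer z (k + 1)) hp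
    have h2 : lift (k + 1 + 2) (transfer z (k + 1)) p
        = step z (k + 3) (lift (k + 2) (transfer z k)) p :=
      lift_step z (k + 2) (transfer z k) hp
    rw [h1, h2, ← step_sub, step_congr ih, step_mul, affineTransfer]

/-- The left side is the form in which the affine count over words arises. Its subtracted term is
`z` times the total of a lift, because lifting multiplies totals by the new length. -/
theorem sum_affineTransfer (z : ℂ) (k : ℕ) :
    ∑ p ∈ Finset.range (k + 3), (transfer z (k + 1) (k + 3 + p) + z * transfer z (k + 1) p)
      - (k + 3) * z * transfer z (k + 1) 0
      = 2 * z * ∑ p ∈ Finset.range (2 * (k + 3)), affineTransfer z k p := by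
  rw [Finset.mul_sum, ← Finset.sum_congr rfl fun p hp =>
    affineTransfer_eq z k p (Finset.mem_range.1 hp), Finset.sum_sub_distrib, sum_halfTurn,
    ← Finset.mul_sum, sum_lift, transfer, step_zero]
  push_cast
  ring

/-! ### Continued fraction certificates and cones -/

theorem wedge_mul_mul (d a b : ℂ) : wedge (d * a) (d * b) = Complex.normSq d * wedge a b := by
  simp only [wedge, Complex.mul_re, Complex.mul_im, Complex.normSq_apply]; ring

/-- Two consecutive continuants with linear entries `q.1 * z + q.2`, starting from the constant `c`
and the linear polynomial `a * z + b`. -/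
def continuant (z : ℂ) (c a b : ℝ) : List (ℝ × ℝ) → ℂ × ℂ
  | [] => (c, a * z + b)
  | q :: l =>
    ((continuant z c a b l).2,
      (q.1 * z + q.2) * (continuant z c a b l).2 - (continuant z c a b l).1)

/-- Passing from `(r₁, r₂)` to `(r₂, (q₁ z + q₂) r₂ - r₁)` increases the area by `q₁ * Im z *
|r₂|²`. This is the algebraic form of the statement that a continued fraction with such entries maps
the upper half plane to itself. -/
theorem wedge_continuant_pos {z : ℂ} (hz : 0 < z.im) {c a b : ℝ} (hc : 0 < c) (ha : 0 < a)
    {l : List (ℝ × ℝ)} (hl : ∀ q ∈ l, 0 ≤ q.1) :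
    0 < wedge (continuant z c a b l).1 (continuant z c a b l).2 := by
  induction l with
  | nil =>
    have : wedge c (a * z + b) = c * a * z.im := by simp [wedge]; ring
    rw [continuant, this]
    positivity
  | cons q l ih =>
    have hq := hl q (by simp)
    have h := ih fun q hq => hl q (by simp [hq])
    rw [continuant]
    generalize continuant z c a b l = r at *
    have : wedge r.2 ((q.1 * z + q.2) * r.2 - r.1)
        = q.1 * (z.im * Complex.normSq r.2) + wedge r.1 r.2 := by
      simp [wedge, Complex.normSq_apply]; ring
    simp only [this]
    have := mul_nonneg hq (mul_nonneg hz.le (Complex.normSq_nonneg r.2))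
    linarith

theorem wedge_pos_of_continuant {z f g : ℂ} (hz : 0 < z.im) (c a b : ℝ) (l : List (ℝ × ℝ))
    (hc : 0 < c) (ha : 0 < a) (hl : ∀ q ∈ l, 0 ≤ q.1) (hf : (continuant z c a b l).1 = f)
    (hg : (continuant z c a b l).2 = g) : 0 < wedge f g := by
  rw [← hf, ← hg]
  exact wedge_continuant_pos hz hc ha hl

/-- The factor `d` accommodates a common divisor of `f` and `g`. It may vanish, so only the weak
inequality survives. -/
theorem wedge_nonneg_of_continuant {z f g : ℂ} (hz : 0 < z.im) (d : ℂ) (c a b : ℝ)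
    (l : List (ℝ × ℝ)) (hc : 0 < c) (ha : 0 < a) (hl : ∀ q ∈ l, 0 ≤ q.1)
    (hf : d * (continuant z c a b l).1 = f) (hg : d * (continuant z c a b l).2 = g) :
    0 ≤ wedge f g := by
  rw [← hf, ← hg, wedge_mul_mul]
  exact mul_nonneg (Complex.normSq_nonneg d) (wedge_continuant_pos hz hc ha hl).le

/-- Cramer's rule in the real basis `u`, `z * u` of `ℂ`: the two areas are, up to a positive factor,
the coordinates. -/
theorem exists_coords {z u a : ℂ} (hz : 0 < z.im) (h1 : 0 ≤ wedge u a) (h2 : 0 ≤ wedge a (z * u))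
    (hu : u ≠ 0) : ∃ x y : ℝ, 0 ≤ x ∧ 0 ≤ y ∧ a = (x + y * z) * u := by
  have hn := mul_pos hz (Complex.normSq_pos.2 hu)
  refine ⟨wedge a (z * u) / (z.im * Complex.normSq u), wedge u a / (z.im * Complex.normSq u),
    div_nonneg h2 hn.le, div_nonneg h1 hn.le, ?_⟩
  have hn' : ((z.im * Complex.normSq u : ℝ) : ℂ) ≠ 0 := by exact_mod_cast hn.ne'
  have key : ((z.im * Complex.normSq u : ℝ) : ℂ) * a
      = ((wedge a (z * u) : ℝ) + (wedge u a : ℝ) * z) * u := by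
    apply Complex.ext <;> simp [wedge, Complex.normSq_apply] <;> ring
  rw [Complex.ofReal_div, Complex.ofReal_div]
  field_simp
  rw [mul_comm, key]
  ring

theorem wedge_coords (z u : ℂ) (a b c d : ℝ) :
    wedge ((a + b * z) * u) ((c + d * z) * u) = (a * d - b * c) * (z.im * Complex.normSq u) := by
  simp [wedge, Complex.normSq_apply]; ring

theorem wedge_coords_mul (z u : ℂ) (a b c d : ℝ) :
    wedge ((c + d * z) * u) (z * ((a + b * z) * u))
      = (c * a + 2 * z.re * (c * b) + Complex.normSq z * (d * b))
        * (z.im * Complex.normSq u) := by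
  simp [wedge, Complex.normSq_apply]; ring

/-- The discriminant is controlled by `(c b)² ≤ (c a) (d b)`, obtained by multiplying the last
hypothesis by `b c`; then complete the square after multiplying by `c a`, the case `c a = 0` being
separate. -/
theorem quadratic_nonneg {a b c d x r : ℝ} (ha : 0 ≤ a) (hb : 0 ≤ b) (hc : 0 ≤ c) (hd : 0 ≤ d)
    (hr : x ^ 2 ≤ r) (h : b * c ≤ a * d) : 0 ≤ c * a + 2 * x * (c * b) + r * (d * b) := by
  have hr0 : 0 ≤ r := (sq_nonneg x).trans hr
  rcases (mul_nonneg hc ha).eq_or_lt with h0 | h0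
  · have : c * b = 0 := by
      rcases mul_eq_zero.1 h0.symm with h1 | h1
      · simp [h1]
      · rw [h1, zero_mul] at h
        linarith [mul_nonneg hb hc, mul_comm b c]
    rw [this, ← h0]
    have := mul_nonneg hr0 (mul_nonneg hd hb)
    linarith
  · refine nonneg_of_mul_nonneg_right (a := c * a) ?_ h0
    have h1 : (c * b) ^ 2 ≤ (c * a) * (d * b) := by
      have := mul_le_mul_of_nonneg_left h (mul_nonneg hb hc)
      linarith
    have h2 : x ^ 2 * (c * b) ^ 2 ≤ r * ((c * a) * (d * b)) := by
      apply mul_le_mul hr h1 (sq_nonneg _) hr0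
    linarith [sq_nonneg (c * a + x * (c * b))]

/-- To see that a sequence is interlaced it suffices to compare consecutive entries, and the first
entry and its multiple by `z` with all others. -/
theorem interlaced_of_consecutive {z : ℂ} (hz : 0 < z.im) {m : ℕ} {h : ℕ → ℂ}
    (hne : ∀ i < m, h i ≠ 0) (hfst : ∀ i < m, 0 ≤ wedge (h 0) (h i))
    (hlst : ∀ i < m, 0 ≤ wedge (h i) (z * h 0))
    (hcon : ∀ i, i + 1 < m → 0 ≤ wedge (h i) (h (i + 1))) : Interlaced z m h := by
  rcases Nat.eq_zero_or_pos m with rfl | hm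
  · intro i j _ hj
    omega
  have hu := hne 0 hm
  have hn := mul_pos hz (Complex.normSq_pos.2 hu)
  have ex : ∀ i, ∃ x y : ℝ, i < m → 0 ≤ x ∧ 0 ≤ y ∧ h i = (x + y * z) * h 0 := fun i => by
    by_cases hi : i < m
    · obtain ⟨x, y, H⟩ := exists_coords hz (hfst i hi) (hlst i hi) hu
      exact ⟨x, y, fun _ => H⟩
    · exact ⟨0, 0, fun h => absurd h hi⟩
  choose x y hxy using ex
  have con : ∀ i, i + 1 < m → y i * x (i + 1) ≤ x i * y (i + 1) := fun i hi => by
    have := hcon i hi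
    rw [(hxy i (by omega)).2.2, (hxy (i + 1) hi).2.2, wedge_coords] at this
    linarith [nonneg_of_mul_nonneg_left this hn]
  -- All entries lie in the cone spanned by `h 0` and `z * h 0`, whose angle is less than `π`. There
  -- the angular order is a comparison of slopes, which is transitive through nonzero vectors.
  have all : ∀ i j, i ≤ j → j < m → y i * x j ≤ x i * y j := fun i j hij => by
    induction j, hij using Nat.le_induction with
    | base => exact fun _ => by rw [mul_comm]
    | succ j hij ih =>
      intro hj
      have h1 := ih (by omega)
      have h2 := con j hj
      obtain ⟨hxi, hyi, -⟩ := hxy i (by omega)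
      obtain ⟨hxj, hyj, hj'⟩ := hxy j (by omega)
      obtain ⟨hxk, hyk, -⟩ := hxy (j + 1) hj
      -- If `y j = 0`, the slope inequality cannot be divided by `y j`; instead `h j ≠ 0` forces `x
      -- j > 0`, and then `y i = 0`.
      rcases hyj.eq_or_lt with h0 | h0
      · have hx : 0 < x j := hxj.lt_of_ne fun hx => hne j (by omega) (by
          rw [hj', ← h0, ← hx]; simp)
        rw [← h0, mul_zero] at h1
        have : y i = 0 := le_antisymm (nonpos_of_mul_nonpos_left h1 hx) hyi
        rw [this, zero_mul]
        exact mul_nonneg hxi hyk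
      · refine le_of_mul_le_mul_left ?_ h0
        calc y j * (y i * x (j + 1)) = y i * (y j * x (j + 1)) := by ring
          _ ≤ y i * (x j * y (j + 1)) := mul_le_mul_of_nonneg_left h2 hyi
          _ = (y i * x j) * y (j + 1) := by ring
          _ ≤ (x i * y j) * y (j + 1) := mul_le_mul_of_nonneg_right h1 hyk
          _ = y j * (x i * y (j + 1)) := by ring
  intro i j hij hj
  obtain ⟨hxi, hyi, hi'⟩ := hxy i (by omega)
  obtain ⟨hxj, hyj, hj'⟩ := hxy j hj
  rw [hi', hj', wedge_coords, wedge_coords_mul]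
  have h1 := all i j hij hj
  refine ⟨mul_nonneg (by linarith) hn.le, mul_nonneg ?_ hn.le⟩
  refine quadratic_nonneg hxi hyi hxj hyj ?_ h1
  rw [Complex.normSq_apply]
  nlinarith [mul_self_nonneg z.im]

/-! ### Explicit sequences and the interlacing of the third iterate -/

theorem affineTransfer_one (z : ℂ) : ∀ p < 8, affineTransfer z 1 p =
    [2 + 8 * z + 2 * z ^ 2,
      2 + 6 * z + 4 * z ^ 2,
      2 + 4 * z + 6 * z ^ 2,
      1 + 5 * z + 5 * z ^ 2 + z ^ 3,
      1 + 5 * z + 5 * z ^ 2 + z ^ 3,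
      6 * z + 4 * z ^ 2 + 2 * z ^ 3,
      4 * z + 6 * z ^ 2 + 2 * z ^ 3,
      2 * z + 8 * z ^ 2 + 2 * z ^ 3].getD p 0 := by
  intro p hp
  interval_cases p <;>
    simp [affineTransfer, step, window, thr, Finset.sum_range_succ] <;> ring

theorem affineTransfer_two (z : ℂ) : ∀ p < 10, affineTransfer z 2 p =
    [8 + 40 * z + 40 * z ^ 2 + 8 * z ^ 3,
      6 + 34 * z + 46 * z ^ 2 + 10 * z ^ 3,
      4 + 30 * z + 48 * z ^ 2 + 14 * z ^ 3,
      2 + 28 * z + 46 * z ^ 2 + 20 * z ^ 3,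
      1 + 24 * z + 46 * z ^ 2 + 24 * z ^ 3 + z ^ 4,
      1 + 24 * z + 46 * z ^ 2 + 24 * z ^ 3 + z ^ 4,
      20 * z + 46 * z ^ 2 + 28 * z ^ 3 + 2 * z ^ 4,
      14 * z + 48 * z ^ 2 + 30 * z ^ 3 + 4 * z ^ 4,
      10 * z + 46 * z ^ 2 + 34 * z ^ 3 + 6 * z ^ 4,
      8 * z + 40 * z ^ 2 + 40 * z ^ 3 + 8 * z ^ 4].getD p 0 := by
  intro p hp
  rw [affineTransfer, step_congr (affineTransfer_one z)]
  interval_cases p <;>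
    simp [step, window, thr, Finset.sum_range_succ] <;> ring

theorem affineTransfer_three (z : ℂ) : ∀ p < 12, affineTransfer z 3 p =
    [22 + 232 * z + 452 * z ^ 2 + 232 * z ^ 3 + 22 * z ^ 4,
      14 + 200 * z + 452 * z ^ 2 + 264 * z ^ 3 + 30 * z ^ 4,
      8 + 172 * z + 440 * z ^ 2 + 300 * z ^ 3 + 40 * z ^ 4,
      4 + 146 * z + 422 * z ^ 2 + 334 * z ^ 3 + 54 * z ^ 4,
      2 + 120 * z + 404 * z ^ 2 + 360 * z ^ 3 + 74 * z ^ 4,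
      1 + 97 * z + 382 * z ^ 2 + 382 * z ^ 3 + 97 * z ^ 4 + z ^ 5,
      1 + 97 * z + 382 * z ^ 2 + 382 * z ^ 3 + 97 * z ^ 4 + z ^ 5,
      74 * z + 360 * z ^ 2 + 404 * z ^ 3 + 120 * z ^ 4 + 2 * z ^ 5,
      54 * z + 334 * z ^ 2 + 422 * z ^ 3 + 146 * z ^ 4 + 4 * z ^ 5,
      40 * z + 300 * z ^ 2 + 440 * z ^ 3 + 172 * z ^ 4 + 8 * z ^ 5,
      30 * z + 264 * z ^ 2 + 452 * z ^ 3 + 200 * z ^ 4 + 14 * z ^ 5,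
      22 * z + 232 * z ^ 2 + 452 * z ^ 3 + 232 * z ^ 4 + 22 * z ^ 5].getD p 0 := by
  intro p hp
  rw [affineTransfer, step_congr (affineTransfer_two z)]
  interval_cases p <;>
    simp [step, window, thr, Finset.sum_range_succ] <;> ring

/-- Strictness matters: it shows at the same time that the first entry and the other entries are
nonzero, as the comparison of slopes requires. -/
theorem wedge_affineTransfer_zero_pos {z : ℂ} (hz : 0 < z.im) {i : ℕ} (h1 : 1 ≤ i)
    (h2 : i < 11) : 0 < wedge (affineTransfer z 3 0) (affineTransfer z 3 i) := by
  rw [affineTransfer_three z i (by omega), affineTransfer_three z 0 (by norm_num)]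
  interval_cases i <;>
    simp only [List.getD_cons_zero, List.getD_cons_succ]
  -- Each list holds the successive quotients of the Euclidean algorithm with negated remainders,
  -- the division of the second polynomial by the first at its head; the other numbers are the final
  -- constant and linear remainders. The same holds for the certificates of the other areas, after
  -- removal of the factor `d`.
  · exact wedge_pos_of_continuant hz (1205405/107217) (66189312/3134053) (24385536/2651891)
      [(0, 15/11), (121/288, 32263/10368), (373248/772343, 26448768/29170801), (220051263289/42890674176, 3459013553411/814922809344)]
      (by norm_num) (by norm_num) (by norm_num)
      (by simp only [continuant]; push_cast; ring) (by simp only [continuant]; push_cast; ring)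
  · exact wedge_pos_of_continuant hz (138469326690/19536356939) (7589785728/191372459) (40132952832/2105097049)
      [(0, 20/11), (121/670, 30041/22445), (15038150/12857339, 56767894000/23156067539), (223685507329691/85176370332480, 19613564104180181/13393984234782480)]
      (by norm_num) (by norm_num) (by norm_num)
      (by simp only [continuant]; push_cast; ring) (by simp only [continuant]; push_cast; ring)
  · exact wedge_pos_of_continuant hz (465665367427529994912/111191393120913738605) (1465654459441200/23928338080691) (746275776178800/23928338080691)
      [(0, 27/11), (121/1295, 1194919/1677025), (2171747375/713847244, 6273118690738025/1052846875550404), (388208595281852726491/307242396230547303750, 91293820340433784870499153/159832068041657453557757250)]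
      (by norm_num) (by norm_num) (by norm_num)
      (by simp only [continuant]; push_cast; ring) (by simp only [continuant]; push_cast; ring)
  · exact wedge_pos_of_continuant hz (2632785334775734875/787317906702422048) (557030686470144/4805185816475) (240428356064256/4805185816475)
      [(0, 37/11), (121/2312, 551793/1336336), (772402208/79973135, 834479597496144/52857043981225), (34935070363730945375/93047519929345794048, 44708559091335486146101775/202007282336848871027736576)]
      (by norm_num) (by norm_num) (by norm_num)
      (by simp only [continuant]; push_cast; ring) (by simp only [continuant]; push_cast; ring)
  · exact wedge_pos_of_continuant hz (442250692481312/173699510199121) (2211279442797600/13820334140041) (823853795940000/13820334140041)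
      [(1/22, 951/242), (1331/33290, 7082735/22164482), (184463901445/9896174002, 91417142085430585/3344520861889922), (565158807502589964521/3063241462928589677700, 177520249207714240456343/1347485883526031837112700)]
      (by norm_num) (by norm_num) (by norm_num)
      (by simp only [continuant]; push_cast; ring) (by simp only [continuant]; push_cast; ring)
  · exact wedge_pos_of_continuant hz (442250692481312/173699510199121) (2211279442797600/13820334140041) (823853795940000/13820334140041)
      [(1/22, 951/242), (1331/33290, 7082735/22164482), (184463901445/9896174002, 91417142085430585/3344520861889922), (565158807502589964521/3063241462928589677700, 177520249207714240456343/1347485883526031837112700)]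
      (by norm_num) (by norm_num) (by norm_num)
      (by simp only [continuant]; push_cast; ring) (by simp only [continuant]; push_cast; ring)
  · exact wedge_pos_of_continuant hz (39575384539549293003250/21529875400453507854627) (2007850372189030656/9849596821168225) (57911039154722304/895417892833475)
      [(1/11, 544/121), (1331/41148, 55150711/211644738), (4354378839612/132095274685, 51660206319807557856/1191801215361355225), (10752770228336524826189125/106237741491287469915772032, 56937314315744669848063030258525/656162616715434396154580184392544)]
      (by norm_num) (by norm_num) (by norm_num)
      (by simp only [continuant]; push_cast; ring) (by simp only [continuant]; push_cast; ring)
  · exact wedge_pos_of_continuant hz (107707461991831835461980960/93225879180036512990186929) (21169327102997633808/100628662266884521) (6376636995476016/118805976702343)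
      [(2/11, 571/121), (1331/45677, 492860951/2086388329), (95299959703733/1688880403364, 3038243512180570123681/48704272537172108164), (351135900246437306706793241/5520929625059705511453378354, 80015674140158968992634585128221363/1167032317691953622979497401163709846)]
      (by norm_num) (by norm_num) (by norm_num)
      (by simp only [continuant]; push_cast; ring) (by simp only [continuant]; push_cast; ring)
  · exact wedge_pos_of_continuant hz (13768347087019579654875/18278916950296924162592) (10082639099776309248/58639864933323025) (197273577751444992/5330896812120275)
      [(4/11, 482/121), (1331/39236, 211546115/769731848), (15100599394064/322310561045, 424129847551135671224/7095423656932086025), (156200394762498890115426125/1940232106746968726020632576, 1450431044559990651751876744725275/18909897919705733585417193294741504)]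
      (by norm_num) (by norm_num) (by norm_num)
      (by simp only [continuant]; push_cast; ring) (by simp only [continuant]; push_cast; ring)
  · exact wedge_pos_of_continuant hz (126730600262769360/151102685640665521) (3064625557424256/48004015251049) (439346318208/30517492213)
      [(7/11, 288/121), (1331/23464, 7877463/17204978), (201848801896/9221824183, 196323209594293152/5808485845376929), (3658550320026648630727/13181703823430515286592, 341464267391333148781125979/1747010752830716482477897536)]
      (by norm_num) (by norm_num) (by norm_num)
      (by simp only [continuant]; push_cast; ring) (by simp only [continuant]; push_cast; ring)

theorem affineTransfer_three_eleven (z : ℂ) :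
    affineTransfer z 3 11 = z * affineTransfer z 3 0 := by
  rw [affineTransfer_three z 11 (by norm_num), affineTransfer_three z 0 (by norm_num)]
  simp only [List.getD_cons_zero, List.getD_cons_succ]
  ring

theorem wedge_affineTransfer_mul_zero_nonneg {z : ℂ} (hz : 0 < z.im) {i : ℕ} (h1 : 1 ≤ i)
    (h2 : i < 11) : 0 ≤ wedge (affineTransfer z 3 i) (z * affineTransfer z 3 0) := by
  rw [affineTransfer_three z i (by omega), affineTransfer_three z 0 (by norm_num)]
  interval_cases i <;>
    simp only [List.getD_cons_zero, List.getD_cons_succ]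
  · exact wedge_nonneg_of_continuant hz (1) (254932115802000/207697586888089) (5639247215232/151745307025) (83334700416/11672715925)
      [(11/15, 32/25), (1125/8152, 1871775/2076722), (8464718872/1022555625, 309298102923616/26555428729375), (2068906896876876875/2927787188827757376, 19597784539416310898125/41407694211590972568768)]
      (by norm_num) (by norm_num) (by norm_num)
      (by simp only [continuant]; push_cast; ring) (by simp only [continuant]; push_cast; ring)
  · exact wedge_nonneg_of_continuant hz (1) (15668530250998286/6440962689064215) (122192952991200/5505456869641) (397799602200/93312828299)
      [(11/20, 67/40), (16/117, 255064/342225), (1001008125/150167744, 1565942078203425/176174619828512), (12917844340676422811/6533981771470846875, 14397364414272477557003689/13886828274469506163762500)]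
      (by norm_num) (by norm_num) (by norm_num)
      (by simp only [continuant]; push_cast; ring) (by simp only [continuant]; push_cast; ring)
  · exact wedge_nonneg_of_continuant hz (1) (116421828912147706401438000/40102171371413511284056561) (11568747928939174688/797648863194528075) (1898915630682874912/797648863194528075)
      [(11/27, 1295/729), (19683/114178, 2439954252/3259153921), (186061838195969/30447931586355, 12540452904773453028029/1744458063806432900025), (33315168746887283379410609625/9426082543415685138724787912, 1854651249434608420433468837626325925/1045593192526050340910485484551405448)]
      (by norm_num) (by norm_num) (by norm_num)
      (by simp only [continuant]; push_cast; ring) (by simp only [continuant]; push_cast; ring)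
  · exact wedge_nonneg_of_continuant hz (1) (790632858550280818290/594144577022821858489) (16080533480872704/721505423887609) (33251255467008/19500146591557)
      [(11/37, 2312/1369), (50653/188980, 33771861/40583455), (7669461325900/1360582787009, 6192527551834670200/987740925302136721), (717069291800666893207649/326301803448495371756160, 5814057134801650390592388832517/4629588423379147174464902303040)]
      (by norm_num) (by norm_num) (by norm_num)
      (by simp only [continuant]; push_cast; ring) (by simp only [continuant]; push_cast; ring)
  · exact wedge_nonneg_of_continuant hz (1) (2999239500536707051808/212969140296240440025) (114863448488774580000/93726234391772095369) (4866334848278260000/93726234391772095369)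
      [(0, 22), (1/1902, 88271/1808802), (860085351/4685050, 988096901251311/2194969350250), (514177057719438125/49960109967421433922, 17194223457650110662171125/1525789801982755346828741442), (287641149411799182196053105346001/350169095690110950390717562500, 15896460994472715907233980711429812667/32722251484953797981161384062937500)]
      (by norm_num) (by norm_num) (by norm_num)
      (by simp only [continuant]; push_cast; ring) (by simp only [continuant]; push_cast; ring)
  · exact wedge_nonneg_of_continuant hz (1) (2999239500536707051808/212969140296240440025) (114863448488774580000/93726234391772095369) (4866334848278260000/93726234391772095369)
      [(0, 22), (1/1902, 88271/1808802), (860085351/4685050, 988096901251311/2194969350250), (514177057719438125/49960109967421433922, 17194223457650110662171125/1525789801982755346828741442), (287641149411799182196053105346001/350169095690110950390717562500, 15896460994472715907233980711429812667/32722251484953797981161384062937500)]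
      (by norm_num) (by norm_num) (by norm_num)
      (by simp only [continuant]; push_cast; ring) (by simp only [continuant]; push_cast; ring)
  · exact wedge_nonneg_of_continuant hz (z) (12331643334341745/4695622096349312) (10121891905536/22506900529) (6053614731264/22506900529)
      [(0, 11), (1/544, 7661/73984), (10061824/150023, 2980735235328/22506900529), (3376552738062167/93607256342396928, 2637946805426014929359/66700973793851039809536)]
      (by norm_num) (by norm_num) (by norm_num)
      (by simp only [continuant]; push_cast; ring) (by simp only [continuant]; push_cast; ring)
  · exact wedge_nonneg_of_continuant hz (z) (971894882345507520/159944095284192769) (5480642268552/34958752927) (3253213623048/34958752927)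
      [(0, 11/2), (4/571, 75890/326041), (186169411/7914928, 20567273694383/559340046832), (34587001548374282/223364260735120329, 27042980330883432105638/156444998311660483792587)]
      (by norm_num) (by norm_num) (by norm_num)
      (by simp only [continuant]; push_cast; ring) (by simp only [continuant]; push_cast; ring)
  · exact wedge_nonneg_of_continuant hz (z) (15519482273489160/2112002741553961) (7442752108512/90884763841) (3483622177728/90884763841)
      [(0, 11/4), (8/241, 35388/58081), (13997521/2411768, 843156591629/90884763841), (27399120639910111/54035310651810684, 1409006143385619715723/2576011855876107785661)]
      (by norm_num) (by norm_num) (by norm_num)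
      (by simp only [continuant]; push_cast; ring) (by simp only [continuant]; push_cast; ring)
  · exact wedge_nonneg_of_continuant hz (z) (8437835/1179387) (104011776/3134053) (3483648/241081)
      [(0, 11/7), (49/288, 19663/10368), (373248/312767, 26448768/11812969), (140032622093/67399630848, 24213094873877/14086522847232)]
      (by norm_num) (by norm_num) (by norm_num)
      (by simp only [continuant]; push_cast; ring) (by simp only [continuant]; push_cast; ring)

theorem wedge_affineTransfer_succ_nonneg {z : ℂ} (hz : 0 < z.im) {i : ℕ} (h1 : 1 ≤ i)
    (h2 : i < 10) : 0 ≤ wedge (affineTransfer z 3 i) (affineTransfer z 3 (i + 1)) := by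
  rw [affineTransfer_three z i (by omega), affineTransfer_three z (i + 1) (by omega)]
  interval_cases i <;>
    simp only [List.getD_cons_zero, List.getD_cons_succ]
  · exact wedge_nonneg_of_continuant hz (1) (6681703000/2218315801) (352677312/23863225) (181741248/23863225)
      [(0, 4/3), (15/26, 553/169), (13182/34195, 146099824/167042575), (816002978875/89403698592, 1017132094686925/323909599998816)]
      (by norm_num) (by norm_num) (by norm_num)
      (by simp only [continuant]; push_cast; ring) (by simp only [continuant]; push_cast; ring)
  · exact wedge_nonneg_of_continuant hz (1) (13856984947200/5576158009321) (1005951714/78447605) (508465506/78447605)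
      [(0, 27/20), (40/71, 14420/5041), (357911/507008, 582290951/502064672), (19886781657920/2535501295137, 181322769985069120/84328237574961483)]
      (by norm_num) (by norm_num) (by norm_num)
      (by simp only [continuant]; push_cast; ring) (by simp only [continuant]; push_cast; ring)
  · exact wedge_nonneg_of_continuant hz (1 + z) (104316069560/34675281369) (80444016/1739761) (7774704/1739761)
      [(0, 37/27), (729/1319, 4232034/1739761), (2294744759/1085994216, 97894147192813/67408746981336)]
      (by norm_num) (by norm_num) (by norm_num)
      (by simp only [continuant]; push_cast; ring) (by simp only [continuant]; push_cast; ring)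
  · exact wedge_nonneg_of_continuant hz (1 + z) (48153372480/39757568449) (826284592/16719921) (47685008/16719921)
      [(1/74, 3409/2738), (50653/49068, 653293645/200639052), (205103270907/141397950806, 721736540665065/761993556893534)]
      (by norm_num) (by norm_num) (by norm_num)
      (by simp only [continuant]; push_cast; ring) (by simp only [continuant]; push_cast; ring)
  -- The two middle entries coincide: no letter lies between `1` and `-1`, so they impose the same
  -- threshold.
  · rw [wedge_self]
  · exact wedge_nonneg_of_continuant hz (1 + z) (48153372480/39757568449) (826284592/16719921) (47685008/16719921)
      [(0, 2), (1/74, 3409/2738), (50653/49068, 653293645/200639052), (205103270907/141397950806, 721736540665065/761993556893534)]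
      (by norm_num) (by norm_num) (by norm_num)
      (by simp only [continuant]; push_cast; ring) (by simp only [continuant]; push_cast; ring)
  · exact wedge_nonneg_of_continuant hz (z + z ^ 2) (397354920/8473921) (139728/2209) (1776/47)
      [(0, 2), (1/47, 2627/2209), (103823/69864, 758290057/203374104)]
      (by norm_num) (by norm_num) (by norm_num)
      (by simp only [continuant]; push_cast; ring) (by simp only [continuant]; push_cast; ring)
  · exact wedge_nonneg_of_continuant hz (z) (1548029168/92181615) (107092800/4206601) (98971200/4206601)
      [(0, 2), (1/30, 497/450), (6750/2051, 18245475/4206601), (8627738651/6023970000, 24052995370117/14933421630000)]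
      (by norm_num) (by norm_num) (by norm_num)
      (by simp only [continuant]; push_cast; ring) (by simp only [continuant]; push_cast; ring)
  · exact wedge_nonneg_of_continuant hz (z) (41062888608/2459267281) (1202085840/61105489) (751609680/61105489)
      [(0, 7/4), (8/101, 14828/10201), (1030301/437752, 1233005071/427738423), (3343631252591/1532809706730, 2131779434345897/752609566004430)]
      (by norm_num) (by norm_num) (by norm_num)
      (by simp only [continuant]; push_cast; ring) (by simp only [continuant]; push_cast; ring)

theorem affineTransfer_three_ne_zero {z : ℂ} (hz : 0 < z.im) {i : ℕ} (hi : i < 12) :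
    affineTransfer z 3 i ≠ 0 := by
  have h0 : affineTransfer z 3 0 ≠ 0 := fun h => by
    have := wedge_affineTransfer_zero_pos hz (i := 1) le_rfl (by norm_num)
    simp [h, wedge] at this
  rcases Nat.eq_zero_or_pos i with rfl | h1
  · exact h0
  rcases (show i < 11 ∨ i = 11 by omega) with h2 | rfl
  · intro h
    have := wedge_affineTransfer_zero_pos hz h1 h2
    simp [h, wedge] at this
  · rw [affineTransfer_three_eleven]
    refine mul_ne_zero (fun h => ?_) h0
    simp [h] at hz

theorem interlaced_affineTransfer_three {z : ℂ} (hz : 0 < z.im) :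
    Interlaced z 12 (affineTransfer z 3) := by
  have hself : 0 ≤ wedge (affineTransfer z 3 0) (z * affineTransfer z 3 0) := by
    rw [wedge_mul_self]
    exact mul_nonneg hz.le (Complex.normSq_nonneg _)
  refine interlaced_of_consecutive hz (fun i hi => affineTransfer_three_ne_zero hz hi)
    (fun i hi => ?_) (fun i hi => ?_) (fun i hi => ?_)
  · rcases (show i = 0 ∨ (1 ≤ i ∧ i < 11) ∨ i = 11 by omega) with rfl | ⟨h1, h2⟩ | rfl
    · rw [wedge_self]
    · exact (wedge_affineTransfer_zero_pos hz h1 h2).le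
    · rwa [affineTransfer_three_eleven]
  · rcases (show i = 0 ∨ (1 ≤ i ∧ i < 11) ∨ i = 11 by omega) with rfl | ⟨h1, h2⟩ | rfl
    · exact hself
    · exact wedge_affineTransfer_mul_zero_nonneg hz h1 h2
    · rw [affineTransfer_three_eleven, wedge_self]
  · rcases (show i = 0 ∨ (1 ≤ i ∧ i < 10) ∨ i = 10 by omega) with rfl | ⟨h1, h2⟩ | rfl
    · exact (wedge_affineTransfer_zero_pos hz le_rfl (by norm_num)).le
    · exact wedge_affineTransfer_succ_nonneg hz h1 h2
    · rw [affineTransfer_three_eleven]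
      exact wedge_affineTransfer_mul_zero_nonneg hz (by norm_num) (by norm_num)

/-! ### Nonvanishing of the totals in the upper half plane -/

theorem interlaced_affineTransfer {z : ℂ} (hz : 0 < z.im) (k : ℕ) :
    Interlaced z (2 * (k + 6)) (affineTransfer z (k + 3)) := by
  induction k with
  | zero => exact interlaced_affineTransfer_three hz
  | succ k ih => exact ih.step hz

theorem sum_affineTransfer_add_three_ne_zero {z : ℂ} (hz : 0 < z.im) (k : ℕ) :
    ∑ p ∈ Finset.range (2 * (k + 6)), affineTransfer z (k + 3) p ≠ 0 := by
  intro h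
  have h0 := (interlaced_affineTransfer hz k).eq_zero_of_sum_eq_zero hz h
    (show 0 < 2 * (k + 6) by omega)
  induction k with
  | zero => exact affineTransfer_three_ne_zero hz (by norm_num) h0
  | succ k ih =>
    -- The first entry of an iterate is the total of the previous one, so vanishing descends to the
    -- third iterate.
    have h1 : ∑ p ∈ Finset.range (2 * (k + 6)), affineTransfer z (k + 3) p = 0 := by
      rwa [show k + 1 + 3 = (k + 3) + 1 by rfl, affineTransfer, step_zero] at h0
    exact ih h1 ((interlaced_affineTransfer hz k).eq_zero_of_sum_eq_zero hz h1 (by omega))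

/-- Interlacing is not available this early: at `z = i / 2` already the first and third entries of
the initial sequence are in the wrong order. The total is the quadratic `2 + 8 z + 2 z²`, treated by
real and imaginary parts. -/
theorem sum_affineTransfer_zero_ne_zero {z : ℂ} (hz : 0 < z.im) :
    ∑ p ∈ Finset.range 6, affineTransfer z 0 p ≠ 0 := by
  rw [← step_zero z 3]
  change affineTransfer z 1 0 ≠ 0
  rw [affineTransfer_one z 0 (by norm_num)]
  simp only [List.getD_cons_zero]
  intro h
  have hre := congrArg Complex.re h
  have him := congrArg Complex.im h
  simp [pow_two] at hre him
  have h2 : z.re = -2 := by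
    have : z.im * (z.re + 2) = 0 := by linarith
    rcases mul_eq_zero.1 this with h | h <;> linarith
  rw [h2] at hre
  nlinarith [mul_pos hz hz]

theorem sum_affineTransfer_one_ne_zero {z : ℂ} (hz : 0 < z.im) :
    ∑ p ∈ Finset.range 8, affineTransfer z 1 p ≠ 0 := by
  have h0 := sum_affineTransfer_zero_ne_zero hz
  rw [← step_zero z 3] at h0
  change affineTransfer z 1 0 ≠ 0 at h0
  rw [← step_zero z 4]
  change affineTransfer z 2 0 ≠ 0
  rw [affineTransfer_one z 0 (by norm_num)] at h0
  rw [affineTransfer_two z 0 (by norm_num)]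
  simp only [List.getD_cons_zero] at h0 ⊢
  have h1 : z + 1 ≠ 0 := fun h => by
    have := congrArg Complex.im h
    simp at this
    exact hz.ne' this
  have h2 : 8 + 40 * z + 40 * z ^ 2 + 8 * z ^ 3 = 4 * (z + 1) * (2 + 8 * z + 2 * z ^ 2) := by ring
  rw [h2]
  exact mul_ne_zero (mul_ne_zero (by norm_num) h1) h0

/-- The refined type `D` affine Eulerian polynomials have no zero in the upper half plane. -/
theorem sum_affineTransfer_ne_zero {z : ℂ} (hz : 0 < z.im) (k : ℕ) :
    ∑ p ∈ Finset.range (2 * (k + 3)), affineTransfer z k p ≠ 0 := by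
  match k with
  | 0 => exact sum_affineTransfer_zero_ne_zero hz
  | 1 => exact sum_affineTransfer_one_ne_zero hz
  | 2 =>
    rw [← step_zero]
    exact affineTransfer_three_ne_zero hz (i := 0) (by norm_num)
  | k + 3 => exact sum_affineTransfer_add_three_ne_zero hz k

/-! ### Signed words and their last letters -/

/-- The letters of signed words of length `n` in decreasing order: `n, …, 1, -1, …, -n`. -/
def letter (n p : ℕ) : ℤ := if p < n then n - p else n - 1 - p

/-- The odd increasing map from the nonzero integers onto those different from `±v`. -/
def avoid (v y : ℤ) : ℤ := if |y| < |v| then y else y + y.sign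

/-- The signed word of length `n + 1` whose last letter is the `p`-th one, and whose other letters
are in the same relative order as those of `u`. -/
def append (n : ℕ) (u : ℕ → ℤ) (p : ℕ) : ℕ → ℤ :=
  Function.update (fun i => avoid (letter (n + 1) p) (u i)) n (letter (n + 1) p)

open Classical in
/-- The signed words of length `n`, extended by zeros. -/
def signedWords : ℕ → Finset (ℕ → ℤ)
  | 0 => {0}
  | n + 1 => (signedWords n ×ˢ Finset.range (2 * (n + 1))).image fun x => append n x.1 x.2

theorem letter_ne_zero {n p : ℕ} : letter n p ≠ 0 := by
  rw [letter]; split_ifs <;> omega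

theorem abs_letter_le {n p : ℕ} (hp : p < 2 * n) : |letter n p| ≤ n := by
  rw [letter, abs_le]; split_ifs <;> omega

theorem exists_letter {n : ℕ} {v : ℤ} (h1 : 1 ≤ |v|) (h2 : |v| ≤ n) :
    ∃ p < 2 * n, letter n p = v := by
  rw [abs_le] at h2
  rw [le_abs] at h1
  by_cases h : 0 < v
  · exact ⟨(n - v).toNat, by omega, by rw [letter]; split_ifs <;> omega⟩
  · exact ⟨(n - 1 - v).toNat, by omega, by rw [letter]; split_ifs <;> omega⟩

theorem letter_injective {n p q : ℕ} (h : letter n p = letter n q) : p = q := by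
  simp only [letter] at h; split_ifs at h <;> omega

theorem avoid_zero (v : ℤ) : avoid v 0 = 0 := by
  simp [avoid]

theorem avoid_of_pos (v : ℤ) {y : ℤ} (hy : 0 < y) :
    avoid v y = if y < |v| then y else y + 1 := by
  rw [avoid, abs_of_pos hy, Int.sign_eq_one_of_pos hy]

theorem avoid_of_neg (v : ℤ) {y : ℤ} (hy : y < 0) :
    avoid v y = if -y < |v| then y else y - 1 := by
  rw [avoid, abs_of_neg hy, Int.sign_eq_neg_one_of_neg hy, sub_eq_add_neg]

theorem avoid_strictMono (v : ℤ) : StrictMono (avoid v) := by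
  intro x y h
  rcases lt_trichotomy x 0 with hx | rfl | hx
  · rw [avoid_of_neg v hx]
    rcases lt_trichotomy y 0 with hy | rfl | hy
    · rw [avoid_of_neg v hy]
      split_ifs <;> omega
    · rw [avoid_zero]
      split_ifs <;> omega
    · rw [avoid_of_pos v hy]
      split_ifs <;> omega
  · rw [avoid_zero, avoid_of_pos v h]
    split_ifs <;> omega
  · rw [avoid_of_pos v hx, avoid_of_pos v (hx.trans h)]
    split_ifs <;> omega

theorem avoid_neg (v y : ℤ) : avoid v (-y) = -avoid v y := by
  simp only [avoid, abs_neg, Int.sign_neg]; split_ifs <;> ring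

theorem avoid_neg_left (v y : ℤ) : avoid (-v) y = avoid v y := by
  simp only [avoid, abs_neg]

theorem abs_avoid (v : ℤ) {y : ℤ} (hy : y ≠ 0) :
    |avoid v y| = if |y| < |v| then |y| else |y| + 1 := by
  rw [avoid]
  split_ifs
  · rfl
  · rcases hy.lt_or_gt with h | h
    · rw [Int.sign_eq_neg_one_of_neg h, abs_of_neg h, abs_of_neg] <;> omega
    · rw [Int.sign_eq_one_of_pos h, abs_of_pos h, abs_of_pos]
      omega

theorem avoid_add_neg_iff (v x y : ℤ) : avoid v x + avoid v y < 0 ↔ x + y < 0 := by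
  rw [← lt_neg_iff_add_neg, ← avoid_neg, (avoid_strictMono v).lt_iff_lt, lt_neg_iff_add_neg]

theorem exists_avoid {v y : ℤ} (hv : v ≠ 0) (h : |y| ≠ |v|) : ∃ x, avoid v x = y := by
  have hv' := abs_pos.2 hv
  rcases h.lt_or_gt with h | h
  · exact ⟨y, if_pos h⟩
  · rcases lt_trichotomy y 0 with hy | rfl | hy
    · refine ⟨y + 1, ?_⟩
      rw [abs_of_neg hy] at h
      rw [avoid, abs_of_neg (by omega), if_neg (by omega), Int.sign_eq_neg_one_of_neg (by omega)]
      omega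
    · rw [abs_zero] at h
      omega
    · refine ⟨y - 1, ?_⟩
      rw [abs_of_pos hy] at h
      rw [avoid, abs_of_pos (by omega), if_neg (by omega), Int.sign_eq_one_of_pos (by omega)]
      omega

/-- Exactly `p` letters are larger than the last one. The preceding letter ranges over all letters
except the last one and its opposite, so one of these `p` is lost precisely when the last letter is
negative. -/
theorem letter_lt_avoid_iff {n p q : ℕ} (hp : p < 2 * (n + 1)) :
    letter (n + 1) p < avoid (letter (n + 1) p) (letter n q) ↔ q < thr n p := by
  have hl : |letter (n + 1) p| = if p < n + 1 then (n : ℤ) + 1 - p else p - n := by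
    rw [letter]
    split_ifs
    · rw [abs_of_pos] <;> (push_cast; omega)
    · rw [abs_of_neg] <;> (push_cast; omega)
  rcases lt_or_ge q n with h | h
  · rw [avoid_of_pos _ (by rw [letter, if_pos h]; omega), hl]
    simp only [letter, thr]
    push_cast
    split_ifs <;> omega
  · rw [avoid_of_neg _ (by rw [letter, if_neg (by omega)]; omega), hl]
    simp only [letter, thr]
    push_cast
    split_ifs <;> omega

theorem letter_reflect {n p : ℕ} (hp : p < 2 * (n + 1)) :
    letter (n + 1) (2 * n + 1 - p) = -letter (n + 1) p := by
  simp only [letter]; split_ifs <;> omega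

theorem append_of_ne {n i : ℕ} (u : ℕ → ℤ) (p : ℕ) (hi : i ≠ n) :
    append n u p i = avoid (letter (n + 1) p) (u i) := Function.update_of_ne hi _ _

theorem append_self (n : ℕ) (u : ℕ → ℤ) (p : ℕ) : append n u p n = letter (n + 1) p :=
  Function.update_self _ _ _

theorem mem_signedWords {n : ℕ} {u : ℕ → ℤ} : u ∈ signedWords n ↔
    (∀ i < n, 1 ≤ |u i| ∧ |u i| ≤ n) ∧ (∀ i, n ≤ i → u i = 0) ∧
      ∀ i < n, ∀ j < n, |u i| = |u j| → i = j := by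
  classical
  induction n generalizing u with
  | zero =>
    simp only [signedWords, Finset.mem_singleton]
    constructor
    · rintro rfl
      simp
    · rintro ⟨-, h, -⟩
      exact funext fun i => h i (Nat.zero_le i)
  | succ n ih =>
    simp only [signedWords, Finset.mem_image, Finset.mem_product, Finset.mem_range, Prod.exists]
    constructor
    · rintro ⟨u, p, ⟨hu, hp⟩, rfl⟩
      obtain ⟨h1, h2, h3⟩ := ih.1 hu
      have hv := abs_letter_le (n := n + 1) hp
      have hv0 : letter (n + 1) p ≠ 0 := letter_ne_zero
      have hv1 := abs_pos.2 hv0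
      have ne : ∀ i < n, u i ≠ 0 := fun i hi h => by
        have := (h1 i hi).1
        simp [h] at this
      have ab : ∀ i < n, |append n u p i|
          = if |u i| < |letter (n + 1) p| then |u i| else |u i| + 1 := fun i hi => by
        rw [append_of_ne u p hi.ne, abs_avoid _ (ne i hi)]
      refine ⟨fun i hi => ?_, fun i hi => ?_, fun i hi j hj hij => ?_⟩
      · rcases (show i < n ∨ i = n by omega) with h | rfl
        · have := h1 i h
          rw [ab i h]
          push_cast
          split_ifs <;> omega
        · rw [append_self]
          exact ⟨hv1, hv⟩
      · rw [append_of_ne u p (by omega), h2 i (by omega), avoid_zero]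
      · rcases (show i < n ∨ i = n by omega) with h | rfl <;>
          rcases (show j < _ ∨ j = _ from Nat.lt_succ_iff_lt_or_eq.1 hj) with h' | h'
        · apply h3 i h j h'
          rw [ab i h, ab j h'] at hij
          split_ifs at hij <;> omega
        · subst h'
          rw [ab i h, append_self] at hij
          split_ifs at hij <;> omega
        · rw [ab j h', append_self] at hij
          split_ifs at hij <;> omega
        · exact h'.symm
    · rintro ⟨h1, h2, h3⟩
      obtain ⟨p, hp, hv⟩ := exists_letter (h1 n (by omega)).1 (h1 n (by omega)).2
      have hv0 : letter (n + 1) p ≠ 0 := letter_ne_zero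
      have ex : ∀ i, ∃ x, i ≠ n → avoid (letter (n + 1) p) x = u i := fun i => by
        by_cases hi : i = n
        · exact ⟨0, fun h => absurd hi h⟩
        · obtain ⟨x, hx⟩ := exists_avoid hv0 (y := u i) (fun h => by
            rw [hv] at h
            rcases Nat.lt_or_ge i n with h' | h'
            · exact hi (h3 i (by omega) n (by omega) h)
            · rw [h2 i (by omega), abs_zero] at h
              have := (h1 n (by omega)).1
              omega)
          exact ⟨x, fun _ => hx⟩
      choose w hw using ex
      have inj := (avoid_strictMono (letter (n + 1) p)).injective
      have ne : ∀ i < n, w i ≠ 0 := fun i hi h => by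
        have h4 := hw i hi.ne
        have h5 := (h1 i (by omega)).1
        rw [← h4, h, avoid_zero, abs_zero] at h5
        omega
      -- The shorter word must vanish from position `n` on, so the arbitrary value `w n` is replaced
      -- by zero.
      refine ⟨fun i => if i = n then 0 else w i, p, ⟨ih.2 ⟨fun i hi => ?_, fun i hi => ?_,
        fun i hi j hj hij => ?_⟩, hp⟩, ?_⟩
      · simp only [if_neg hi.ne]
        have h4 := abs_avoid (letter (n + 1) p) (ne i hi)
        rw [hw i hi.ne] at h4
        have h5 := h1 i (by omega)
        have h6 := abs_pos.2 (ne i hi)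
        have h7 := abs_letter_le hp
        push_cast at h5 h7
        split_ifs at h4 <;> omega
      · by_cases h : i = n
        · simp [h]
        · simp only [if_neg h]
          apply inj
          rw [hw i h, h2 i (by omega), avoid_zero]
      · simp only [if_neg hi.ne, if_neg hj.ne] at hij
        apply h3 i (by omega) j (by omega)
        rw [← hw i hi.ne, ← hw j hj.ne, abs_avoid _ (ne i hi), abs_avoid _ (ne j hj), hij]
      · funext i
        by_cases h : i = n
        · rw [h, append_self, hv]
        · rw [append_of_ne _ _ h]
          simp only [if_neg h]
          exact hw i h

theorem sum_signedWords_succ {M : Type*} [AddCommMonoid M] (n : ℕ) (F : (ℕ → ℤ) → M) :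
    ∑ u ∈ signedWords (n + 1), F u
      = ∑ u ∈ signedWords n, ∑ p ∈ Finset.range (2 * (n + 1)), F (append n u p) := by
  classical
  rw [signedWords, Finset.sum_image, Finset.sum_product]
  rintro ⟨u, p⟩ hu ⟨u', p'⟩ hu' h
  simp only [Finset.coe_product, Set.mem_prod, Finset.mem_coe] at hu hu' h
  have hp : p = p' := letter_injective (by
    rw [← append_self n u p, ← append_self n u' p', h])
  subst hp
  refine Prod.ext (funext fun i => ?_) rfl
  by_cases hi : i = n
  -- At position `n` the letter of the shorter word was overwritten; it is recovered because both
  -- words vanish there.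
  · change u i = u' i
    rw [(mem_signedWords.1 hu.1).2.1 i hi.ge, (mem_signedWords.1 hu'.1).2.1 i hi.ge]
  · apply (avoid_strictMono (letter (n + 1) p)).injective
    rw [← append_of_ne u p hi, ← append_of_ne u' p hi, h]

/-! ### Descents of words and the recursion by last letter -/

/-- The number of type `D` descents of the word formed by the first `n` letters of `u`. -/
def des (n : ℕ) (u : ℕ → ℤ) : ℕ :=
  (if u 0 + u 1 < 0 then 1 else 0) + ∑ i ∈ Finset.range (n - 1), if u (i + 1) < u i then 1 else 0

theorem des_succ {n : ℕ} (hn : 1 ≤ n) (u : ℕ → ℤ) :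
    des (n + 1) u = des n u + if u n < u (n - 1) then 1 else 0 := by
  obtain ⟨m, rfl⟩ := Nat.exists_eq_add_of_le' hn
  simp only [des, Nat.add_sub_cancel]
  rw [Finset.sum_range_succ, add_assoc]

theorem des_two (u : ℕ → ℤ) :
    des 2 u = (if u 0 + u 1 < 0 then 1 else 0) + if u 1 < u 0 then 1 else 0 := by
  rw [des, show 2 - 1 = 1 from rfl, Finset.sum_range_one]

/-- Relabelling by `avoid` is increasing and odd, so it preserves all old comparisons, including the
sign of the sum of the first two letters. Only the new last comparison contributes. -/
theorem des_append {n : ℕ} (hn : 2 ≤ n) (u : ℕ → ℤ) (p : ℕ) :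
    des (n + 1) (append n u p) = des n u
      + if letter (n + 1) p < avoid (letter (n + 1) p) (u (n - 1)) then 1 else 0 := by
  rw [des_succ (by omega), append_self, append_of_ne _ _ (by omega), des, des]
  simp only [append_of_ne u p (show 0 ≠ n by omega), append_of_ne u p (show 1 ≠ n by omega),
    avoid_add_neg_iff]
  congr 2
  refine Finset.sum_congr rfl fun i hi => ?_
  rw [Finset.mem_range] at hi
  simp only [append_of_ne u p (show i ≠ n by omega), append_of_ne u p (show i + 1 ≠ n by omega),
    (avoid_strictMono _).lt_iff_lt]

/-- The arbitrary weight `φ` of the last letter encodes the whole distribution by last letter, and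
lets the induction absorb the factor of the next descent. -/
theorem sum_signedWords_des (z : ℂ) (k : ℕ) (φ : ℤ → ℂ) :
    ∑ u ∈ signedWords (k + 2), z ^ des (k + 2) u * φ (u (k + 1))
      = ∑ p ∈ Finset.range (2 * (k + 2)), transfer z k p * φ (letter (k + 2) p) := by
  induction k generalizing φ with
  | zero =>
    rw [sum_signedWords_succ, sum_signedWords_succ, signedWords, Finset.sum_singleton]
    simp [Finset.sum_range_succ, transfer, append, letter, avoid, des_two]
    ring
  | succ k ih =>
    rw [show k + 1 + 2 = k + 2 + 1 by rfl, sum_signedWords_succ, Finset.sum_comm]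
    refine Finset.sum_congr rfl fun p hp => ?_
    rw [Finset.mem_range] at hp
    have := ih fun y => (if letter (k + 2 + 1) p < avoid (letter (k + 2 + 1) p) y then z else 1)
      * φ (letter (k + 2 + 1) p)
    rw [transfer, step, window, Finset.sum_mul]
    calc _ = _ := Finset.sum_congr rfl fun u _ => by
          rw [des_append (by omega), append_self, pow_add]
          simp only [show k + 2 - 1 = k + 1 by rfl]
          split_ifs <;> ring
      _ = _ := this
      _ = _ := Finset.sum_congr rfl fun q hq => by
          rw [Finset.mem_range] at hq
          simp only [letter_lt_avoid_iff hp]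
          ring

/-- The number of type `D` affine descents of the word formed by the first `n` letters of `u`. -/
def affineWordDes (n : ℕ) (u : ℕ → ℤ) : ℕ := des n u + if 0 < u (n - 2) + u (n - 1) then 1 else 0

/-- The sum of the last two letters is positive exactly when the opposite of the last letter is
smaller than its predecessor. The affine condition is thus a second descent condition, at the
reflected position. -/
theorem affineWordDes_append {n : ℕ} (hn : 2 ≤ n) (u : ℕ → ℤ) {p : ℕ} (hp : p < 2 * (n + 1)) :
    affineWordDes (n + 1) (append n u p) = des n u
      + (if letter (n + 1) p < avoid (letter (n + 1) p) (u (n - 1)) then 1 else 0)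
      + if letter (n + 1) (2 * n + 1 - p) < avoid (letter (n + 1) (2 * n + 1 - p)) (u (n - 1))
        then 1 else 0 := by
  rw [affineWordDes, des_append hn, letter_reflect hp, avoid_neg_left, Nat.add_sub_cancel,
    append_self, append_of_ne u p (by omega), show n + 1 - 2 = n - 1 by omega]
  simp only [neg_lt_iff_pos_add]

theorem sum_range_two_mul_of_symm {M : Type*} [AddCommMonoid M] {n : ℕ} {F : ℕ → M}
    (hF : ∀ p < n, F (n + p) = F (n - 1 - p)) :
    ∑ p ∈ Finset.range (2 * n), F p = 2 • ∑ p ∈ Finset.range n, F p := by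
  rw [two_mul, Finset.sum_range_add, two_nsmul]
  congr 1
  rw [Finset.sum_congr rfl fun p hp => hF p (Finset.mem_range.1 hp), Finset.sum_range_reflect]

theorem sum_signedWords_affineWordDes (z : ℂ) (k : ℕ) :
    ∑ u ∈ signedWords (k + 3), z ^ affineWordDes (k + 3) u
      = 2 * (2 * z * ∑ p ∈ Finset.range (2 * (k + 3)), affineTransfer z k p) := by
  have key : ∀ p < 2 * (k + 3), ∑ u ∈ signedWords (k + 2),
      z ^ affineWordDes (k + 3) (append (k + 2) u p) = ∑ q ∈ Finset.range (2 * (k + 2)),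
        transfer z k q * ((if q < thr (k + 2) p then z else 1)
          * if q < thr (k + 2) (2 * (k + 2) + 1 - p) then z else 1) := fun p hp => by
    have h1 : p < 2 * (k + 2 + 1) := hp
    have h2 : 2 * (k + 2) + 1 - p < 2 * (k + 2 + 1) := by omega
    have := sum_signedWords_des z k fun y =>
      (if letter (k + 2 + 1) p < avoid (letter (k + 2 + 1) p) y then z else 1)
      * if letter (k + 2 + 1) (2 * (k + 2) + 1 - p)
          < avoid (letter (k + 2 + 1) (2 * (k + 2) + 1 - p)) y then z else 1
    simp only [letter_lt_avoid_iff h1, letter_lt_avoid_iff h2] at this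
    rw [← this]
    refine Finset.sum_congr rfl fun u _ => ?_
    rw [affineWordDes_append (n := k + 2) (by omega) u h1, pow_add, pow_add, mul_assoc]
    simp only [show k + 2 - 1 = k + 1 by rfl, pow_ite, pow_one, pow_zero]
  rw [show k + 3 = k + 2 + 1 by rfl, sum_signedWords_succ, Finset.sum_comm]
  -- The weight is symmetric under negation of the last letter, so only positive last letters
  -- remain, with a factor two.
  rw [Finset.sum_congr rfl fun p hp => key p (Finset.mem_range.1 hp), sum_range_two_mul_of_symm,
    nsmul_eq_mul, Nat.cast_ofNat]
  · congr 1
    rw [← sum_affineTransfer, Finset.sum_add_distrib]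
    have h1 : ∑ p ∈ Finset.range (k + 3), transfer z (k + 1) (k + 3 + p)
        = ∑ p ∈ Finset.range (k + 3), transfer z (k + 1) (2 * (k + 2) + 1 - p) := by
      rw [← Finset.sum_range_reflect]
      refine Finset.sum_congr rfl fun p hp => ?_
      rw [Finset.mem_range] at hp
      congr 1
      omega
    have h2 : ((k : ℂ) + 3) * z * transfer z (k + 1) 0
        = ∑ p ∈ Finset.range (k + 3), z * transfer z (k + 1) 0 := by
      simp
      ring
    rw [h1, h2, ← Finset.sum_add_distrib, ← Finset.sum_sub_distrib]
    refine Finset.sum_congr rfl fun p hp => ?_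
    rw [Finset.mem_range] at hp
    simp only [transfer]
    rw [step_zero, step, step, window, window, Finset.mul_sum, Finset.mul_sum,
      ← Finset.sum_add_distrib, ← Finset.sum_sub_distrib]
    refine Finset.sum_congr rfl fun q _ => ?_
    -- For a positive last letter the first descent condition implies the second. Hence the product
    -- `a b` of the two factors, each `z` or `1`, equals `b + z a - z`, which is linear in the two
    -- windows.
    have h3 : q < thr (k + 2) p → q < thr (k + 2) (2 * (k + 2) + 1 - p) := fun h =>
      h.trans_le (thr_mono _ (by omega))
    by_cases ha : q < thr (k + 2) p
    · rw [if_pos ha, if_pos (h3 ha)]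
      ring
    · rw [if_neg ha]
      ring
  · intro p hp
    refine Finset.sum_congr rfl fun q _ => ?_
    rw [show 2 * (k + 2) + 1 - (k + 2 + 1 + p) = k + 2 + 1 - 1 - p by omega,
      show 2 * (k + 2) + 1 - (k + 2 + 1 - 1 - p) = k + 2 + 1 + p by omega]
    ring

/-! ### Roots, the exchange condition and length -/

theorem e_succ {n : ℕ} (j : Fin n) : e n (j + 1) = EuclideanSpace.single j 1 := by
  ext i
  simp [e, Fin.ext_iff]

/-- The roots of type `D` are the integer vectors of squared length two. -/
def IsRoot {n : ℕ} (v : E n) : Prop := IsIntegral v ∧ ‖v‖ ^ 2 = 2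

/-- A vector whose scalar products with `e_b + e_a` and `e_b - e_a` are positive for `a < b`. -/
def IsDominant {n : ℕ} (v : E n) : Prop := ∀ a b : Fin n, a < b → |v a| < v b

/-- Half the sum of the positive roots. -/
def rho (n : ℕ) : E n := WithLp.toLp 2 fun j => (j : ℝ)

theorem isDominant_rho (n : ℕ) : IsDominant (rho n) := fun a b h => by
  simpa [rho] using h

theorem IsRoot.eq_single {n : ℕ} {v : E n} (hv : IsRoot v) :
    ∃ a b : Fin n, a < b ∧ (v a = 1 ∨ v a = -1) ∧ (v b = 1 ∨ v b = -1) ∧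
      ∀ j, j ≠ a → j ≠ b → v j = 0 := by
  obtain ⟨hi, hn⟩ := hv
  choose m hm using hi
  have hs : ∑ j, m j ^ 2 = 2 := by
    rw [EuclideanSpace.norm_sq_eq] at hn
    have : ((∑ j, m j ^ 2 : ℤ) : ℝ) = (2 : ℤ) := by
      push_cast
      rw [← hn]
      exact Finset.sum_congr rfl fun j _ => by rw [hm, Real.norm_eq_abs, sq_abs]
    exact_mod_cast this
  have unit : ∀ k : ℤ, 0 < k ^ 2 → k ^ 2 ≤ 2 → k = 1 ∨ k = -1 := fun k h0 h2 => by
    have h3 : k < 2 := by nlinarith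
    have h4 : -2 < k := by nlinarith
    have h5 : k ≠ 0 := fun h => by simp [h] at h0
    omega
  have pos_of_sum : ∀ s : Finset (Fin n), 0 < ∑ j ∈ s, m j ^ 2 → ∃ a ∈ s, 0 < m a ^ 2 :=
    fun s h => Finset.exists_lt_of_sum_lt (by simpa using h)
  obtain ⟨a, -, ha0⟩ := pos_of_sum Finset.univ (by omega)
  have ha : m a = 1 ∨ m a = -1 := unit _ ha0 (hs ▸ Finset.single_le_sum
    (f := fun j => m j ^ 2) (fun j _ => sq_nonneg (m j)) (Finset.mem_univ a))
  have ha2 : m a ^ 2 = 1 := by rcases ha with h | h <;> simp [h]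
  rw [← Finset.add_sum_erase _ _ (Finset.mem_univ a), ha2] at hs
  obtain ⟨b, hb, hb0⟩ := pos_of_sum (Finset.univ.erase a) (by omega)
  have hb1 : m b ^ 2 ≤ 1 := by
    have := Finset.single_le_sum (f := fun j => m j ^ 2) (fun j _ => sq_nonneg (m j)) hb
    omega
  have hb2 : m b = 1 ∨ m b = -1 := unit _ hb0 (by omega)
  have hb3 : m b ^ 2 = 1 := by omega
  rw [← Finset.add_sum_erase _ _ hb, hb3] at hs
  have h0 : ∀ j, j ≠ a → j ≠ b → v j = 0 := fun j hja hjb => by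
    have := Finset.single_le_sum (f := fun j => m j ^ 2) (fun j _ => sq_nonneg (m j))
      (show j ∈ (Finset.univ.erase a).erase b by simp [hja, hjb])
    have h1 : m j ^ 2 = 0 := le_antisymm (by omega) (sq_nonneg _)
    rw [hm, pow_eq_zero_iff two_ne_zero |>.1 h1, Int.cast_zero]
  have hva : v a = 1 ∨ v a = -1 := by
    rw [hm]; exact ha.imp (fun h => by simp [h]) fun h => by simp [h]
  have hvb : v b = 1 ∨ v b = -1 := by
    rw [hm]; exact hb2.imp (fun h => by simp [h]) fun h => by simp [h]
  rcases lt_or_gt_of_ne (Finset.ne_of_mem_erase hb) with h | h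
  · exact ⟨b, a, h, hvb, hva, fun j h1 h2 => h0 j h2 h1⟩
  · exact ⟨a, b, h, hva, hvb, h0⟩

/-- Every root is positive or negative, irrespective of the dominant vector used. -/
theorem IsRoot.exists_sign {n : ℕ} {v : E n} (hv : IsRoot v) :
    ∃ s : ℝ, (s = 1 ∨ s = -1) ∧ ∀ r : E n, IsDominant r → 0 < s * inner ℝ v r := by
  obtain ⟨a, b, hab, ha, hb, h0⟩ := hv.eq_single
  -- The coordinate of larger index decides the sign, since a dominant vector satisfies `|r a| < r
  -- b`.
  refine ⟨v b, hb, fun r hr => ?_⟩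
  have : inner ℝ v r = v a * r a + v b * r b := by
    rw [PiLp.inner_apply, ← Finset.sum_subset (Finset.subset_univ {a, b}),
      Finset.sum_pair hab.ne]
    · simp [mul_comm]
    · intro j _ hj
      simp only [Finset.mem_insert, Finset.mem_singleton, not_or] at hj
      simp [h0 j hj.1 hj.2]
  rw [this]
  have := hr a b hab
  rw [abs_lt] at this
  rcases ha with ha | ha <;> rcases hb with hb | hb <;> rw [ha, hb] <;> linarith

theorem IsRoot.inner_ne_zero {n : ℕ} {v r : E n} (hv : IsRoot v) (hr : IsDominant r) :
    inner ℝ v r ≠ 0 := fun h => by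
  obtain ⟨s, -, hs⟩ := hv.exists_sign
  simpa [h] using hs r hr

theorem IsRoot.inner_pos_iff {n : ℕ} {v r r' : E n} (hv : IsRoot v) (hr : IsDominant r)
    (hr' : IsDominant r') : 0 < inner ℝ v r ↔ 0 < inner ℝ v r' := by
  obtain ⟨s, h, hs⟩ := hv.exists_sign
  have h1 := hs r hr
  have h2 := hs r' hr'
  rcases h with rfl | rfl <;> constructor <;> intro <;> linarith

theorem IsRoot.inner_neg_iff {n : ℕ} {v r r' : E n} (hv : IsRoot v) (hr : IsDominant r)
    (hr' : IsDominant r') : inner ℝ v r < 0 ↔ inner ℝ v r' < 0 := by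
  rw [← not_iff_not, not_lt, not_lt, (hv.inner_ne_zero hr).symm.le_iff_lt,
    (hv.inner_ne_zero hr').symm.le_iff_lt, hv.inner_pos_iff hr hr']

theorem IsRoot.refl_apply {n : ℕ} {v : E n} (hv : IsRoot v) (x : E n) :
    refl n v x = x - inner ℝ v x • v := by
  rw [TypeD.refl_apply, hv.2]
  congr 2
  ring

theorem IsIntegral.exists_inner {n : ℕ} {v w : E n} (hv : IsIntegral v) (hw : IsIntegral w) :
    ∃ m : ℤ, inner ℝ v w = m := by
  choose a ha using hv
  choose b hb using hw
  refine ⟨∑ j, b j * a j, ?_⟩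
  rw [PiLp.inner_apply]
  push_cast
  exact Finset.sum_congr rfl fun j _ => by simp [ha, hb]

theorem isIntegral_rho (n : ℕ) : IsIntegral (rho n) := fun j => ⟨j, by simp [rho]⟩

theorem isRoot_single_add {n : ℕ} {a b : Fin n} (hab : a ≠ b) :
    IsRoot (EuclideanSpace.single a (1 : ℝ) + EuclideanSpace.single b 1) := by
  refine ⟨fun j => ⟨(if j = a then 1 else 0) + if j = b then 1 else 0, by
    simp⟩, ?_⟩
  rw [← real_inner_self_eq_norm_sq]
  simp only [inner_add_left, inner_add_right, EuclideanSpace.inner_single_left]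
  simp [hab, hab.symm]
  norm_num

theorem isRoot_single_sub {n : ℕ} {a b : Fin n} (hab : a ≠ b) :
    IsRoot (EuclideanSpace.single b (1 : ℝ) - EuclideanSpace.single a 1) := by
  refine ⟨fun j => ⟨(if j = b then 1 else 0) - if j = a then 1 else 0, by
    simp⟩, ?_⟩
  rw [← real_inner_self_eq_norm_sq]
  simp only [inner_sub_left, inner_sub_right, EuclideanSpace.inner_single_left]
  simp [hab, hab.symm]
  norm_num

theorem simpleRoot_zero {n : ℕ} (hn : 2 ≤ n) (i : Fin n) (hi : (i : ℕ) = 0) :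
    simpleRoot n i = EuclideanSpace.single ⟨0, by omega⟩ 1 + EuclideanSpace.single ⟨1, hn⟩ 1 := by
  rw [simpleRoot, if_pos hi, ← e_succ, ← e_succ]

theorem simpleRoot_pos {n : ℕ} (i : Fin n) (hi : (i : ℕ) ≠ 0) :
    simpleRoot n i
      = EuclideanSpace.single i 1 - EuclideanSpace.single ⟨i - 1, by omega⟩ 1 := by
  rw [simpleRoot, if_neg hi, ← e_succ, ← e_succ]
  simp only [show (i : ℕ) - 1 + 1 = i by omega]

theorem isRoot_simpleRoot {n : ℕ} (hn : 2 ≤ n) (i : Fin n) : IsRoot (simpleRoot n i) := by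
  by_cases hi : (i : ℕ) = 0
  · rw [simpleRoot_zero hn i hi]
    exact isRoot_single_add (by simp)
  · rw [simpleRoot_pos i hi]
    exact isRoot_single_sub (by simp [Fin.ext_iff]; omega)

theorem inner_simpleRoot_zero {n : ℕ} (hn : 2 ≤ n) (i : Fin n) (hi : (i : ℕ) = 0) (v : E n) :
    inner ℝ (simpleRoot n i) v = v ⟨0, by omega⟩ + v ⟨1, hn⟩ := by
  rw [simpleRoot_zero hn i hi, inner_add_left]
  simp [EuclideanSpace.inner_single_left]

theorem inner_simpleRoot_pos {n : ℕ} (i : Fin n) (hi : (i : ℕ) ≠ 0) (v : E n) :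
    inner ℝ (simpleRoot n i) v = v i - v ⟨i - 1, by omega⟩ := by
  rw [simpleRoot_pos i hi, inner_sub_left]
  simp [EuclideanSpace.inner_single_left]

theorem inner_simpleRoot_rho {n : ℕ} (hn : 2 ≤ n) (i : Fin n) :
    inner ℝ (simpleRoot n i) (rho n) = 1 := by
  by_cases hi : (i : ℕ) = 0
  · rw [inner_simpleRoot_zero hn i hi]
    simp [rho]
  · rw [inner_simpleRoot_pos i hi]
    simp [rho, Nat.cast_sub (show 1 ≤ (i : ℕ) by omega)]

theorem simpleReflection_mem {n : ℕ} (i : Fin n) : simpleReflection n i ∈ weylGroup n :=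
  Subgroup.subset_closure ⟨i, rfl⟩

theorem prod_mem_weylGroup {n : ℕ} (l : List (Fin n)) :
    (l.map (simpleReflection n)).prod ∈ weylGroup n :=
  Subgroup.list_prod_mem _ fun x hx => by
    obtain ⟨i, -, rfl⟩ := List.mem_map.1 hx
    exact simpleReflection_mem i

theorem IsRoot.map {n : ℕ} {v : E n} (hv : IsRoot v) {w : E n ≃ₗᵢ[ℝ] E n}
    (hw : w ∈ weylGroup n) : IsRoot (w v) :=
  ⟨weylGroup_integral hw hv.1, by rw [w.norm_map, hv.2]⟩

theorem inner_apply_left {n : ℕ} (w : E n ≃ₗᵢ[ℝ] E n) (x y : E n) :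
    inner ℝ (w x) y = inner ℝ x (w⁻¹ y) := by
  rw [← w.inner_map_map x (w⁻¹ y)]
  congr 1
  exact (w.apply_symm_apply y).symm

theorem refl_mul_self {n : ℕ} (v : E n) : refl n v * refl n v = 1 :=
  Submodule.reflection_mul_reflection _

theorem refl_self {n : ℕ} (v : E n) : refl n v v = -v := by
  rw [refl]
  exact Submodule.reflection_orthogonalComplement_singleton_eq_neg v

theorem mul_refl {n : ℕ} (w : E n ≃ₗᵢ[ℝ] E n) (v : E n) :
    w * refl n v = refl n (w v) * w := by
  ext1 x
  change w (refl n v x) = refl n (w v) (w x)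
  rw [TypeD.refl_apply, TypeD.refl_apply, map_sub, map_smul, w.inner_map_map, w.norm_map]

/-- A simple reflection permutes the positive roots other than its own. -/
theorem inner_simpleReflection_pos {n : ℕ} (hn : 2 ≤ n) {v : E n} (hv : IsRoot v) (i : Fin n)
    (hvi : v ≠ simpleRoot n i) (h : 0 < inner ℝ v (rho n)) :
    0 < inner ℝ (simpleReflection n i v) (rho n) := by
  have hi := isRoot_simpleRoot hn i
  have hs : IsRoot (simpleReflection n i v) := hv.map (simpleReflection_mem i)
  refine lt_of_le_of_ne ?_ (hs.inner_ne_zero (isDominant_rho n)).symm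
  rw [simpleReflection, hi.refl_apply, inner_sub_left, inner_smul_left, inner_simpleRoot_rho hn]
  obtain ⟨a, ha⟩ := hv.1.exists_inner (isIntegral_rho n)
  obtain ⟨b, hb⟩ := hi.1.exists_inner hv.1
  -- Two distinct roots have integer scalar product at most one, while the height of `v`, its
  -- product with `rho n`, is an integer at least one. So the reflected root has nonnegative height,
  -- and roots never have height zero.
  have h1 : 0 < ‖simpleRoot n i - v‖ ^ 2 := by
    have := norm_pos_iff.2 (sub_ne_zero.2 hvi.symm)
    positivity
  rw [norm_sub_sq_real, hi.2, hv.2, hb] at h1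
  have h2 : b < 2 := by
    have : (b : ℝ) < (2 : ℤ) := by
      push_cast
      linarith
    exact_mod_cast this
  rw [ha] at h ⊢
  rw [hb]
  have h3 : 0 < a := by exact_mod_cast h
  have h4 : (b : ℝ) ≤ a := by exact_mod_cast (show b ≤ a by omega)
  simpa using h4

/-- The exchange condition. -/
theorem exists_shorter_word {n : ℕ} (hn : 2 ≤ n) {v : E n} (hv : IsRoot v)
    (hpos : 0 < inner ℝ v (rho n)) (l : List (Fin n))
    (hneg : inner ℝ ((l.map (simpleReflection n)).prod v) (rho n) < 0) :
    ∃ l' : List (Fin n), l'.length + 1 = l.length ∧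
      (l'.map (simpleReflection n)).prod = (l.map (simpleReflection n)).prod * refl n v := by
  induction l with
  | nil =>
    simp at hneg
    linarith
  | cons i l ih =>
    have hr := hv.map (prod_mem_weylGroup l)
    rcases lt_or_gt_of_ne (hr.inner_ne_zero (isDominant_rho n)) with h | h
    · obtain ⟨l', h1, h2⟩ := ih h
      exact ⟨i :: l', by simp [h1], by simp [h2, mul_assoc]⟩
    · refine ⟨l, by simp, ?_⟩
      -- The sign changes exactly at the letter `i`, and the only positive root that this reflection
      -- makes negative is its own. Conjugation then deletes that letter.
      have hi : (l.map (simpleReflection n)).prod v = simpleRoot n i := by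
        by_contra hne
        have h1 := inner_simpleReflection_pos hn hr i hne h
        rw [List.map_cons, List.prod_cons] at hneg
        exact lt_asymm h1 hneg
      rw [List.map_cons, List.prod_cons, mul_assoc, mul_refl, hi, ← mul_assoc, simpleReflection,
        refl_mul_self, one_mul]

theorem exists_reduced_word {n : ℕ} {w : E n ≃ₗᵢ[ℝ] E n} (hw : w ∈ weylGroup n) :
    ∃ l : List (Fin n), l.length = length n w ∧ (l.map (simpleReflection n)).prod = w := by
  obtain ⟨l, hl⟩ := exists_word hw
  exact Nat.sInf_mem (s := {k | ∃ l : List (Fin n), l.length = k ∧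
    (l.map (simpleReflection n)).prod = w}) ⟨_, l, rfl, hl⟩

theorem length_mul_refl_lt {n : ℕ} (hn : 2 ≤ n) {v : E n} (hv : IsRoot v)
    (hpos : 0 < inner ℝ v (rho n)) {w : E n ≃ₗᵢ[ℝ] E n} (hw : w ∈ weylGroup n)
    (hneg : inner ℝ (w v) (rho n) < 0) : length n (w * refl n v) < length n w := by
  obtain ⟨l, hl, rfl⟩ := exists_reduced_word hw
  obtain ⟨l', h1, h2⟩ := exists_shorter_word hn hv hpos l hneg
  have : length n ((l.map (simpleReflection n)).prod * refl n v) ≤ l'.length :=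
    Nat.sInf_le ⟨l', rfl, h2⟩
  omega

/-- This is the previous inequality for `w * refl n v`, which sends `v` to `-(w v)`. -/
theorem length_lt_length_mul_refl {n : ℕ} (hn : 2 ≤ n) {v : E n} (hv : IsRoot v)
    (hpos : 0 < inner ℝ v (rho n)) (hmem : refl n v ∈ weylGroup n) {w : E n ≃ₗᵢ[ℝ] E n}
    (hw : w ∈ weylGroup n) (h : 0 < inner ℝ (w v) (rho n)) :
    length n w < length n (w * refl n v) := by
  have := length_mul_refl_lt hn hv hpos (mul_mem hw hmem) (by
    change inner ℝ (w (refl n v v)) (rho n) < 0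
    rw [refl_self, map_neg, inner_neg_left]
    linarith)
  rwa [mul_assoc, refl_mul_self, mul_one] at this

theorem length_mul_refl_lt_iff {n : ℕ} (hn : 2 ≤ n) {v : E n} (hv : IsRoot v)
    (hpos : 0 < inner ℝ v (rho n)) (hmem : refl n v ∈ weylGroup n) {w : E n ≃ₗᵢ[ℝ] E n}
    (hw : w ∈ weylGroup n) :
    length n (w * refl n v) < length n w ↔ inner ℝ (w v) (rho n) < 0 := by
  refine ⟨fun h => ?_, length_mul_refl_lt hn hv hpos hw⟩
  by_contra h1
  have h2 := (not_lt.1 h1).lt_of_ne ((hv.map hw).inner_ne_zero (isDominant_rho n)).symm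
  exact lt_asymm h (length_lt_length_mul_refl hn hv hpos hmem hw h2)

theorem length_lt_length_mul_refl_iff {n : ℕ} (hn : 2 ≤ n) {v : E n} (hv : IsRoot v)
    (hpos : 0 < inner ℝ v (rho n)) (hmem : refl n v ∈ weylGroup n) {w : E n ≃ₗᵢ[ℝ] E n}
    (hw : w ∈ weylGroup n) :
    length n w < length n (w * refl n v) ↔ 0 < inner ℝ (w v) (rho n) := by
  refine ⟨fun h => ?_, length_lt_length_mul_refl hn hv hpos hmem hw⟩
  by_contra h1
  have h2 := (not_lt.1 h1).lt_of_ne ((hv.map hw).inner_ne_zero (isDominant_rho n))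
  exact lt_asymm h (length_mul_refl_lt hn hv hpos hw h2)

theorem refl_apply_mem {n : ℕ} {v : E n} (hv : refl n v ∈ weylGroup n) (i : Fin n) :
    refl n (simpleReflection n i v) ∈ weylGroup n := by
  have hi := simpleReflection_mem i
  rw [eq_mul_inv_of_mul_eq (mul_refl (simpleReflection n i) v).symm]
  exact mul_mem (mul_mem hi hv) (inv_mem hi)

theorem simpleReflection_single_pred {n : ℕ} (hn : 2 ≤ n) {a : ℕ} (ha : a + 1 < n) :
    simpleReflection n ⟨a + 1, ha⟩ (EuclideanSpace.single ⟨a, by omega⟩ 1)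
      = EuclideanSpace.single ⟨a + 1, ha⟩ 1 := by
  rw [simpleReflection, (isRoot_simpleRoot hn _).refl_apply, inner_simpleRoot_pos _ (by simp),
    simpleRoot_pos _ (by simp)]
  simp

theorem simpleReflection_single_of_ne {n : ℕ} (hn : 2 ≤ n) {a : ℕ} (ha : a + 1 < n) {b : Fin n}
    (h1 : (b : ℕ) ≠ a) (h2 : (b : ℕ) ≠ a + 1) :
    simpleReflection n ⟨a + 1, ha⟩ (EuclideanSpace.single b 1) = EuclideanSpace.single b 1 := by
  rw [simpleReflection, (isRoot_simpleRoot hn _).refl_apply, inner_simpleRoot_pos _ (by simp)]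
  simp [Fin.ext_iff, h1.symm, h2.symm]

theorem highestRoot_eq {n : ℕ} (hn : 2 ≤ n) : highestRoot n
    = EuclideanSpace.single ⟨n - 2, by omega⟩ 1 + EuclideanSpace.single ⟨n - 1, by omega⟩ 1 := by
  rw [highestRoot, ← e_succ, ← e_succ]
  simp only [show n - 2 + 1 = n - 1 by omega, show n - 1 + 1 = n by omega]

/-- Conjugating by simple reflections moves first the second index and then the first index of `e_1
+ e_2` upwards to those of the highest root. -/
theorem refl_highestRoot_mem {n : ℕ} (hn : 2 ≤ n) : refl n (highestRoot n) ∈ weylGroup n := by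
  have h1 : ∀ b (hb : b + 1 < n), refl n (EuclideanSpace.single ⟨0, by omega⟩ 1
      + EuclideanSpace.single ⟨b + 1, hb⟩ 1) ∈ weylGroup n := fun b => by
    induction b with
    | zero =>
      intro hb
      rw [← simpleRoot_zero hn ⟨0, by omega⟩ rfl]
      exact simpleReflection_mem _
    | succ b ih =>
      intro hb
      have := refl_apply_mem (ih (by omega)) ⟨b + 1 + 1, hb⟩
      rwa [map_add, simpleReflection_single_pred hn, simpleReflection_single_of_ne hn hb
        (by simp) (by simp)] at this
  have h2 : ∀ a (ha : a + 1 < n), refl n (EuclideanSpace.single ⟨a, by omega⟩ 1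
      + EuclideanSpace.single ⟨n - 1, by omega⟩ 1) ∈ weylGroup n := fun a => by
    induction a with
    | zero =>
      intro ha
      have := h1 (n - 2) (by omega)
      simpa only [show n - 2 + 1 = n - 1 by omega] using this
    | succ a ih =>
      intro ha
      have := refl_apply_mem (ih (by omega)) ⟨a + 1, by omega⟩
      rwa [map_add, simpleReflection_single_pred hn, simpleReflection_single_of_ne hn _
        (by simp only; omega) (by simp only; omega)] at this
  rw [highestRoot_eq hn]
  exact h2 (n - 2) (by omega)

theorem isRoot_highestRoot {n : ℕ} (hn : 2 ≤ n) : IsRoot (highestRoot n) := by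
  rw [highestRoot_eq hn]
  exact isRoot_single_add (by simp [Fin.ext_iff]; omega)

theorem inner_highestRoot {n : ℕ} (hn : 2 ≤ n) (v : E n) :
    inner ℝ (highestRoot n) v = v ⟨n - 2, by omega⟩ + v ⟨n - 1, by omega⟩ := by
  rw [highestRoot_eq hn, inner_add_left]
  simp [EuclideanSpace.inner_single_left]

theorem length_mul_simpleReflection_lt_iff {n : ℕ} (hn : 2 ≤ n) {w : E n ≃ₗᵢ[ℝ] E n}
    (hw : w ∈ weylGroup n) (i : Fin n) {r : E n} (hr : IsDominant r) :
    length n (w * simpleReflection n i) < length n w ↔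
      inner ℝ (simpleRoot n i) (w⁻¹ r) < 0 := by
  have hi := isRoot_simpleRoot hn i
  rw [simpleReflection, length_mul_refl_lt_iff hn hi (by rw [inner_simpleRoot_rho hn]; norm_num)
    (simpleReflection_mem i) hw, (hi.map hw).inner_neg_iff (isDominant_rho n) hr, inner_apply_left]

/-- Signs of roots do not depend on the dominant vector, so `rho n` may be replaced by `r`. Moving
`w` to the other side of the scalar product turns each length comparison into one of coordinates of
`w⁻¹ r`. -/
theorem affineDes_eq_affineWordDes {n : ℕ} (hn : 2 ≤ n) {w : E n ≃ₗᵢ[ℝ] E n}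
    (hw : w ∈ weylGroup n) {r : E n} (hr : IsDominant r) {u : ℕ → ℤ}
    (hu : ∀ j : Fin n, (w⁻¹ r) j = u j) : affineDes n w = affineWordDes n u := by
  have hθ := isRoot_highestRoot hn
  have hpos : 0 < inner ℝ (highestRoot n) (rho n) := by
    rw [inner_highestRoot hn]
    have : (0 : ℝ) < (n - 1 : ℕ) := by exact_mod_cast (show 0 < n - 1 by omega)
    simp only [rho]
    positivity
  rw [affineDes, affineWordDes]
  congr 1
  · obtain ⟨m, rfl⟩ := Nat.exists_eq_add_of_le' (show 1 ≤ n by omega)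
    rw [Finset.card_filter, Fin.sum_univ_succ, des, Nat.add_sub_cancel, Finset.sum_range]
    congr 1
    · refine if_congr ?_ rfl rfl
      rw [length_mul_simpleReflection_lt_iff hn hw _ hr, inner_simpleRoot_zero hn _ (by simp),
        hu, hu, ← Int.cast_add]
      exact Int.cast_lt_zero
    · refine Finset.sum_congr rfl fun i _ => if_congr ?_ rfl rfl
      rw [length_mul_simpleReflection_lt_iff hn hw _ hr, inner_simpleRoot_pos _ (by simp),
        hu, hu, sub_neg]
      simp
  · refine if_congr ?_ rfl rfl
    rw [length_lt_length_mul_refl_iff hn hθ hpos (refl_highestRoot_mem hn) hw,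
      (hθ.map hw).inner_pos_iff (isDominant_rho n) hr, inner_apply_left, inner_highestRoot hn,
      hu, hu, ← Int.cast_add]
    exact Int.cast_pos

/-! ### Group elements and signed words -/

/-- The vector `(s, 2, 3, …, n)`. -/
def baseVector (n : ℕ) (s : ℤˣ) : E n :=
  WithLp.toLp 2 fun j => if (j : ℕ) = 0 then ((s : ℤ) : ℝ) else (j : ℝ) + 1

theorem abs_baseVector {n : ℕ} (s : ℤˣ) (j : Fin n) : |baseVector n s j| = (j : ℝ) + 1 := by
  by_cases h : (j : ℕ) = 0
  · rcases Int.units_eq_one_or s with rfl | rfl <;> simp [baseVector, h]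
  · have : (0 : ℝ) ≤ (j : ℝ) + 1 := by positivity
    simp [baseVector, h, abs_of_nonneg this]

theorem isDominant_baseVector {n : ℕ} (s : ℤˣ) : IsDominant (baseVector n s) := fun a b h => by
  rw [abs_baseVector]
  have h1 : (a : ℕ) < b := h
  have h2 : ((a : ℕ) : ℝ) < (b : ℕ) := by exact_mod_cast h1
  simp [baseVector, show (b : ℕ) ≠ 0 by omega, h2]

theorem isIntegral_baseVector {n : ℕ} (s : ℤˣ) : IsIntegral (baseVector n s) :=
  fun j => ⟨if (j : ℕ) = 0 then s else j + 1, by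
    by_cases h : (j : ℕ) = 0 <;> simp [baseVector, h]⟩

/-- The absolute values of the coordinates are `1, …, n` in some order. -/
def IsSigned {n : ℕ} (v : E n) : Prop :=
  (∀ j, ∃ k : ℕ, 1 ≤ k ∧ k ≤ n ∧ |v j| = k) ∧ ∀ i j, |v i| = |v j| → i = j

theorem isSigned_baseVector {n : ℕ} (s : ℤˣ) : IsSigned (baseVector n s) := by
  refine ⟨fun j => ⟨j + 1, by omega, j.2, by rw [abs_baseVector]; push_cast; rfl⟩,
    fun i j h => ?_⟩
  rw [abs_baseVector, abs_baseVector, add_left_inj, Nat.cast_inj] at h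
  exact Fin.ext h

theorem IsSigned.of_perm {n : ℕ} {v v' : E n} (hv : IsSigned v) (σ : Equiv.Perm (Fin n))
    (h : ∀ j, |v' j| = |v (σ j)|) : IsSigned v' := by
  refine ⟨fun j => by rw [h]; exact hv.1 _, fun i j hij => ?_⟩
  rw [h, h] at hij
  exact σ.injective (hv.2 _ _ hij)

theorem IsSigned.map_simpleReflection {n : ℕ} (hn : 2 ≤ n) {v : E n} (hv : IsSigned v) (i : Fin n) :
    IsSigned (simpleReflection n i v) := by
  by_cases hi : (i : ℕ) = 0
  · refine hv.of_perm (Equiv.swap ⟨0, by omega⟩ ⟨1, hn⟩) fun j => ?_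
    rw [TypeD.simpleReflection, (isRoot_simpleRoot hn i).refl_apply,
      inner_simpleRoot_zero hn i hi, simpleRoot_zero hn i hi]
    by_cases h0 : j = ⟨0, by omega⟩
    · subst h0
      rw [Equiv.swap_apply_left, ← abs_neg]
      congr 1
      simp
    · by_cases h1 : j = ⟨1, hn⟩
      · subst h1
        rw [Equiv.swap_apply_right, ← abs_neg]
        congr 1
        simp
      · rw [Equiv.swap_apply_of_ne_of_ne h0 h1]
        simp [h0, h1]
  · have hne : i ≠ ⟨i - 1, by omega⟩ := by
      rw [Ne, Fin.ext_iff]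
      simp only
      omega
    refine hv.of_perm (Equiv.swap i ⟨i - 1, by omega⟩) fun j => ?_
    rw [TypeD.simpleReflection, (isRoot_simpleRoot hn i).refl_apply,
      inner_simpleRoot_pos i hi, simpleRoot_pos i hi]
    generalize (⟨i - 1, by omega⟩ : Fin n) = k at *
    by_cases h0 : j = i
    · subst h0
      rw [Equiv.swap_apply_left]
      congr 1
      simp [hne]
    · by_cases h1 : j = k
      · subst h1
        rw [Equiv.swap_apply_right]
        congr 1
        simp [h0]
      · rw [Equiv.swap_apply_of_ne_of_ne h0 h1]
        simp [h0, h1]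

theorem IsSigned.map {n : ℕ} (hn : 2 ≤ n) {v : E n} (hv : IsSigned v) {w : E n ≃ₗᵢ[ℝ] E n}
    (hw : w ∈ weylGroup n) : IsSigned (w v) := by
  obtain ⟨l, rfl⟩ := exists_word hw
  clear hw
  induction l with
  | nil => exact hv
  | cons i l ih => exact ih.map_simpleReflection hn i

/-- The only signed vectors in the closed dominant chamber are `(±1, 2, …, n)`. -/
theorem IsSigned.eq_baseVector {n : ℕ} (hn : 2 ≤ n) {v : E n} (hv : IsSigned v)
    (h : ∀ i, 0 ≤ inner ℝ (simpleRoot n i) v) : ∃ s, v = baseVector n s := by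
  have h0 := h ⟨0, by omega⟩
  rw [inner_simpleRoot_zero hn _ rfl] at h0
  have hs : ∀ b (hb : b + 1 < n), v ⟨b, by omega⟩ ≤ v ⟨b + 1, hb⟩ := fun b hb => by
    have := h ⟨b + 1, hb⟩
    rw [inner_simpleRoot_pos _ (by simp)] at this
    simpa using this
  have hle : ∀ b (hb : b + 1 < n), ∀ a (ha : a ≤ b),
      |v ⟨a, by omega⟩| ≤ v ⟨b + 1, hb⟩ := fun b => by
    induction b with
    | zero =>
      intro hb a ha
      obtain rfl : a = 0 := by omega
      rw [abs_le]
      exact ⟨by linarith, hs 0 hb⟩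
    | succ b ih =>
      intro hb a ha
      have h1 := ih (by omega)
      rcases (show a ≤ b ∨ a = b + 1 by omega) with h2 | rfl
      · exact (h1 a h2).trans (hs _ hb)
      · rw [abs_of_nonneg ((abs_nonneg _).trans (h1 b le_rfl))]
        exact hs _ hb
  have hpos : ∀ b (hb : b + 1 < n), 0 ≤ v ⟨b + 1, hb⟩ := fun b hb =>
    (abs_nonneg _).trans (hle b hb b le_rfl)
  choose k hk1 hk2 hk using hv.1
  have hlt : ∀ b (hb : b + 1 < n), k ⟨b, by omega⟩ < k ⟨b + 1, hb⟩ := fun b hb => by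
    have h1 := hle b hb b le_rfl
    rw [← abs_of_nonneg (hpos b hb), hk, hk, Nat.cast_le] at h1
    refine lt_of_le_of_ne h1 fun h2 => ?_
    have := hv.2 ⟨b, by omega⟩ ⟨b + 1, hb⟩ (by rw [hk, hk, h2])
    simp at this
  -- A strictly increasing list of `n` integers between `1` and `n` is `1, …, n`: it is squeezed
  -- from both ends.
  have lower : ∀ b (hb : b < n), b + 1 ≤ k ⟨b, hb⟩ := fun b => by
    induction b with
    | zero => exact fun hb => hk1 _
    | succ b ih =>
      intro hb
      have := ih (by omega)
      have := hlt b hb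
      omega
  have upper : ∀ d b (hb : b < n), b + d + 1 = n → k ⟨b, hb⟩ + d ≤ n := fun d => by
    induction d with
    | zero => exact fun b hb _ => hk2 _
    | succ d ih =>
      intro b hb hd
      have := ih (b + 1) (by omega) (by omega)
      have := hlt b (by omega)
      omega
  have hkeq : ∀ b (hb : b < n), k ⟨b, hb⟩ = b + 1 := fun b hb => by
    have h1 := lower b hb
    have h2 := upper (n - 1 - b) b hb (by omega)
    omega
  have habs : ∀ b (hb : b < n), |v ⟨b, hb⟩| = (b : ℝ) + 1 := fun b hb => by
    rw [hk, hkeq b hb]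
    push_cast
    rfl
  have hz := habs 0 (by omega)
  have hsucc : ∀ j : Fin n, (j : ℕ) ≠ 0 → v j = (j : ℝ) + 1 := fun j hj => by
    obtain ⟨b, hb⟩ := j
    obtain ⟨b, rfl⟩ := Nat.exists_eq_succ_of_ne_zero hj
    rw [← abs_of_nonneg (hpos b hb), habs]
  rw [Nat.cast_zero, zero_add] at hz
  rcases (abs_eq zero_le_one).1 hz with h1 | h1
  · refine ⟨1, ?_⟩
    ext j
    by_cases hj : (j : ℕ) = 0
    · rw [show j = ⟨0, by omega⟩ from Fin.ext hj, h1]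
      simp [baseVector]
    · simp [baseVector, hj, hsucc j hj]
  · refine ⟨-1, ?_⟩
    ext j
    by_cases hj : (j : ℕ) = 0
    · rw [show j = ⟨0, by omega⟩ from Fin.ext hj, h1]
      simp [baseVector]
    · simp [baseVector, hj, hsucc j hj]

theorem IsSigned.exists_apply_eq_baseVector {n : ℕ} (hn : 2 ≤ n) {v : E n} (hv : IsSigned v) :
    ∃ w ∈ weylGroup n, ∃ s, w v = baseVector n s := by
  -- A maximizer over the finite group lands in the closed dominant chamber: applying a further
  -- simple reflection lowers the product with `rho n` by that with the simple root.
  obtain ⟨w, hw⟩ := Finite.exists_max fun w : weylGroup n => inner ℝ (w.1 v) (rho n)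
  refine ⟨w.1, w.2, (hv.map hn w.2).eq_baseVector hn fun i => ?_⟩
  have h1 := hw ⟨simpleReflection n i * w.1, mul_mem (simpleReflection_mem i) w.2⟩
  have h2 : inner ℝ (simpleReflection n i (w.1 v)) (rho n) ≤ inner ℝ (w.1 v) (rho n) := h1
  rw [simpleReflection, (isRoot_simpleRoot hn i).refl_apply, inner_sub_left, inner_smul_left,
    inner_simpleRoot_rho hn] at h2
  simp only [conj_trivial, mul_one] at h2
  linarith

theorem eq_of_inv_apply_baseVector_eq {n : ℕ} (hn : 2 ≤ n) {w w' : E n ≃ₗᵢ[ℝ] E n}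
    (hw : w ∈ weylGroup n) (hw' : w' ∈ weylGroup n) {s s' : ℤˣ}
    (h : w⁻¹ (baseVector n s) = w'⁻¹ (baseVector n s')) : w = w' ∧ s = s' := by
  have hg : w' * w⁻¹ ∈ weylGroup n := mul_mem hw' (inv_mem hw)
  have hgs : (w' * w⁻¹) (baseVector n s) = baseVector n s' := by
    change w' (w⁻¹ (baseVector n s)) = _
    rw [h]
    exact w'.apply_symm_apply _
  have h1 : w' * w⁻¹ = 1 := by
    obtain ⟨l, hl, hlw⟩ := exists_reduced_word hg
    -- The last letter of a nonempty reduced word is a right descent, so its simple root would be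
    -- negative on `baseVector n s`, which is dominant.
    rcases l.eq_nil_or_concat with rfl | ⟨l, i, rfl⟩
    · rw [← hlw]
      rfl
    · exfalso
      have hi := isRoot_simpleRoot hn i
      have h2 : (w' * w⁻¹) * simpleReflection n i = (l.map (simpleReflection n)).prod := by
        rw [← hlw]
        simp only [List.concat_eq_append, List.map_append, List.prod_append, List.map_cons,
          List.map_nil, List.prod_singleton]
        rw [mul_assoc, simpleReflection, refl_mul_self, mul_one]
      have h3 : length n ((w' * w⁻¹) * simpleReflection n i) < length n (w' * w⁻¹) := by
        rw [← hl, h2]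
        have : length n (l.map (simpleReflection n)).prod ≤ l.length := Nat.sInf_le ⟨l, rfl, rfl⟩
        simp only [List.concat_eq_append, List.length_append, List.length_cons, List.length_nil]
        omega
      rw [length_mul_simpleReflection_lt_iff hn hg i (isDominant_baseVector s'), ← hgs] at h3
      have h4 : (w' * w⁻¹)⁻¹ ((w' * w⁻¹) (baseVector n s)) = baseVector n s :=
        (w' * w⁻¹).symm_apply_apply _
      rw [h4, hi.inner_neg_iff (isDominant_baseVector s) (isDominant_rho n),
        inner_simpleRoot_rho hn] at h3
      linarith
  refine ⟨(mul_inv_eq_one.1 h1).symm, ?_⟩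
  rw [h1] at hgs
  have h2 : baseVector n s ⟨0, by omega⟩ = baseVector n s' ⟨0, by omega⟩ := by
    rw [← hgs]
    rfl
  simpa [baseVector, Units.ext_iff] using h2

/-- The word formed by the coordinates of an integer vector. -/
def toWord {n : ℕ} (v : E n) (j : ℕ) : ℤ := if h : j < n then ⌊v ⟨j, h⟩⌋ else 0

theorem IsIntegral.toWord_apply {n : ℕ} {v : E n} (hv : IsIntegral v) (j : Fin n) :
    v j = toWord v j := by
  obtain ⟨m, hm⟩ := hv j
  simp [toWord, hm]

theorem toWord_mem_signedWords {n : ℕ} {v : E n} (hv : IsIntegral v) (h : IsSigned v) :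
    toWord v ∈ signedWords n := by
  have abs_eq : ∀ j (hj : j < n), ((|toWord v j| : ℤ) : ℝ) = |v ⟨j, hj⟩| := fun j hj => by
    rw [hv.toWord_apply, Int.cast_abs]
  refine mem_signedWords.2 ⟨fun j hj => ?_, fun j hj => dif_neg (by omega),
    fun i hi j hj hij => ?_⟩
  · obtain ⟨k, h1, h2, h3⟩ := h.1 ⟨j, hj⟩
    have : |toWord v j| = k := by
      have := abs_eq j hj
      rw [h3] at this
      exact_mod_cast this
    omega
  · have := h.2 ⟨i, hi⟩ ⟨j, hj⟩ (by rw [← abs_eq, ← abs_eq, hij])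
    simpa using this

theorem exists_toWord_eq {n : ℕ} {u : ℕ → ℤ} (hu : u ∈ signedWords n) :
    ∃ v : E n, IsSigned v ∧ toWord v = u := by
  obtain ⟨h1, h2, h3⟩ := mem_signedWords.1 hu
  refine ⟨WithLp.toLp 2 fun j => (u j : ℝ), ⟨fun j => ⟨(u j).natAbs, ?_, ?_, ?_⟩,
    fun i j hij => ?_⟩, funext fun j => ?_⟩
  · have := (h1 j j.2).1
    rw [Int.abs_eq_natAbs] at this
    omega
  · have := (h1 j j.2).2
    rw [Int.abs_eq_natAbs] at this
    omega
  · rw [Nat.cast_natAbs, Int.cast_abs]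
  · refine Fin.ext (h3 i i.2 j j.2 ?_)
    simp only [← Int.cast_abs] at hij
    exact_mod_cast hij
  · by_cases hj : j < n
    · simp [toWord, hj]
    · rw [toWord, dif_neg hj, h2 j (by omega)]

/-- The pairs `(w, s)` correspond bijectively to signed words through `w⁻¹ (baseVector n s)`; the
sign `s` accounts for the factor two, as the group has index two among signed permutations. -/
theorem two_mul_sum_weylGroup {n : ℕ} (hn : 2 ≤ n) (z : ℂ) :
    2 * ∑ w : weylGroup n, z ^ affineDes n (w : E n ≃ₗᵢ[ℝ] E n)
      = ∑ u ∈ signedWords n, z ^ affineWordDes n u := by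
  have hint : ∀ w : weylGroup n, ∀ s, IsIntegral (w.1⁻¹ (baseVector n s)) := fun w s =>
    weylGroup_integral (inv_mem w.2) (isIntegral_baseVector s)
  have hcard : ∑ x : weylGroup n × ℤˣ, z ^ affineDes n x.1.1
      = 2 * ∑ w : weylGroup n, z ^ affineDes n w.1 := by
    rw [Fintype.sum_prod_type, Finset.mul_sum]
    simp
  rw [← hcard]
  refine Finset.sum_bij (fun x _ => toWord (x.1.1⁻¹ (baseVector n x.2))) (fun x _ => ?_)
    (fun x _ y _ h => ?_) (fun u hu => ?_) (fun x _ => ?_)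
  · exact toWord_mem_signedWords (hint _ _)
      ((isSigned_baseVector x.2).map hn (inv_mem x.1.2))
  · have h1 : x.1.1⁻¹ (baseVector n x.2) = y.1.1⁻¹ (baseVector n y.2) := by
      ext j
      rw [(hint x.1 x.2).toWord_apply, (hint y.1 y.2).toWord_apply]
      exact congrArg _ (congrFun h j)
    obtain ⟨h2, h3⟩ := eq_of_inv_apply_baseVector_eq hn x.1.2 y.1.2 h1
    exact Prod.ext (Subtype.ext h2) h3
  · obtain ⟨v, hv, rfl⟩ := exists_toWord_eq hu
    obtain ⟨w, hw, s, hs⟩ := hv.exists_apply_eq_baseVector hn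
    refine ⟨(⟨w, hw⟩, s), Finset.mem_univ _, ?_⟩
    simp only
    rw [← hs]
    congr 1
    exact w.symm_apply_apply v
  · rw [affineDes_eq_affineWordDes hn x.1.2 (isDominant_baseVector x.2)
      (hint x.1 x.2).toWord_apply]

theorem aeval_affineEulerian (k : ℕ) (z : ℂ) : aeval z (affineEulerian (k + 3))
    = 2 * z * ∑ p ∈ Finset.range (2 * (k + 3)), affineTransfer z k p := by
  have h := two_mul_sum_weylGroup (n := k + 3) (by omega) z
  rw [sum_signedWords_affineWordDes] at h
  rw [← mul_left_cancel₀ two_ne_zero h, affineEulerian]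
  simp

theorem aeval_affineEulerian_ne_zero {n : ℕ} (hn : 3 ≤ n) {z : ℂ} (hz : 0 < z.im) :
    aeval z (affineEulerian n) ≠ 0 := by
  obtain ⟨k, rfl⟩ := Nat.exists_eq_add_of_le' hn
  rw [aeval_affineEulerian]
  have h0 : z ≠ 0 := fun h => by simp [h] at hz
  exact mul_ne_zero (mul_ne_zero two_ne_zero h0) (sum_affineTransfer_ne_zero hz k)

end TypeD

end

theorem theorem4p5 (n : ℕ) (hn : 3 ≤ n) (z : ℂ)
    (hz : Polynomial.aeval z (TypeD.affineEulerian n) = 0) : z.im = 0 := by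
  rcases lt_trichotomy z.im 0 with h | h | h
  -- The coefficients are real, so the conjugate of a zero is a zero.
  · refine absurd ?_ (TypeD.aeval_affineEulerian_ne_zero hn (z := (starRingEnd ℂ) z) (by simpa))
    rw [Polynomial.aeval_conj, hz, map_zero]
  · exact h
  · exact absurd hz (TypeD.aeval_affineEulerian_ne_zero hn h)
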